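/- \textbf{Setting.} A network has $V=\sum_{j=1}^d V_j$ nodes divided into $d$ layers; its nodes are the pairs $(j,i)$, $j\in[d]$, $i\in[V_j]$, stacked layer after layer. Let $\theta,\theta_0>0$, let $P_0$ be a diffuse probability measure on a standard Borel space $\mathbb X$, and let $G_1,\dots,G_d$ be diffuse probability measures on a standard Borel space $\mathbb T$. Let $\tilde P_0\sim\mathrm{DP}(\theta_0,P_0)$ and $\tilde Q_j\sim\mathrm{DP}(\theta,G_j)$, $j\in[d]$, be independent. Given these, let $t_{ji}$ ($j\in[d]$, $i\in[V_j]$) be independent with $t_{ji}\sim\tilde Q_j$, and, given all of the former, let $s_{j\tau}$ ($j\in[d]$, $\tau\ge 1$) be i.i.d. from $\tilde P_0$. The subgroup labels $w_{ji}$ number the distinct values of $(t_{j1},\dots,t_{jV_j})$ in order of appearance, separately in each layer; the attribute of node $(j,i)$ is $x_{ji}=s_{j,w_{ji}}$; and $\mathbf z$ is the allocation vector of the nodes into clusters (profiles) induced by the ties of $\mathbf X=(x_{ji})$, labelled in order of appearance. For a node $v$ in layer $j$, let $\mathbf z^{-v},\mathbf w^{-v}$ be $\mathbf z,\mathbf w$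 with $v$ removed and the labels rearranged in order of appearance (within each layer for $\mathbf w$). Let $H^{-v}$ be the number of clusters in $\mathbf z^{-v}$, $n^{-v}_{jh}$ the number of nodes other than $v$ in layer $j$ with profile $h$, $\ell^{-v}_{jh}$ the number of subgroups of layer $j$ with profile $h$ (without $v$), $\ell^{-v}_{\cdot h}=\sum_{j'=1}^d\ell^{-v}_{j'h}$ and $|\boldsymbol\ell^{-v}|=\sum_{j'=1}^d\sum_{h=1}^{H^{-v}}\ell^{-v}_{j'h}$. The event $z_v=h$ means that $v$ belongs to the cluster with label $h$ in $\mathbf z^{-v}$ if $h\le H^{-v}$, and that $v$ shares its cluster with no other node if $h=H^{-v}+1$. \textbf{Corollary.} (i) $\mathbf z\sim\mathrm{pExP}(\mathbf V;\theta,\theta_0)$, the partition structure induced by a hierarchical Dirichlet process: $\mathbf z$ has the same law as the allocation vector induced by the ties of any array $(x'_{ji})$ whose entries, given $(\tilde P_1,\dots,\tilde P_d)$, are independent with $x'_{ji}\sim\tilde P_j$, where $\tilde P_1,\dots,\tilde P_d\mid\tilde P_0'\overset{\mathrm{iid}}{\sim}\mathrm{DP}(\theta,\tilde P_0')$, $\tilde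 P_0'\sim\mathrm{DP}(\theta_0,P_0')$ and $P_0'$ is a diffuse probability measure on $\mathbb X$. (ii) For every node $v$, with $j$ its layer, every value of $(\mathbf z^{-v},\mathbf w^{-v})$ of positive probability, and every $h\in[H^{-v}+1]$, \[ \mathbb P(z_v=h\mid \mathbf z^{-v},\mathbf w^{-v})=\mathbb 1_{\{\ell^{-v}_{\cdot h}=0\}}\,\frac{\theta_0}{\theta_0+|\boldsymbol\ell^{-v}|}\,\frac{\theta}{\theta+V_j-1}+\mathbb 1_{\{\ell^{-v}_{\cdot h}\ne0\}}\left[\frac{\ell^{-v}_{\cdot h}}{\theta_0+|\boldsymbol\ell^{-v}|}\,\frac{\theta}{\theta+V_j-1}+\frac{n^{-v}_{jh}}{\theta+V_j-1}\right]. \] -/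

import Mathlib

open MeasureTheory ProbabilityTheory
open scoped ENNReal

namespace PExP

noncomputable section

/-! ### Dirichlet distributions, Dirichlet processes, hierarchical Dirichlet processes -/

/-- The gamma distribution with shape `a` and rate `1`, with the usual convention that shape `0`
is the point mass at `0`. -/
def unitGamma (a : ℝ) : Measure ℝ :=
  if 0 < a then gammaMeasure a 1 else Measure.dirac 0

/-- The Dirichlet distribution with parameters `a₁, …, aₖ ≥ 0`, not all zero: the law of
`(g₁ / ∑ gᵢ, …, gₖ / ∑ gᵢ)` for independent `gᵢ ∼ Gamma(aᵢ, 1)`. -/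
def dirichletMeasure {k : ℕ} (a : Fin k → ℝ) : Measure (Fin k → ℝ) :=
  (Measure.pi fun i => unitGamma (a i)).map fun g i => g i / ∑ l, g l

/-- `A₁, …, Aₖ` is a measurable partition of the space (empty pieces are allowed). -/
structure IsMeasurablePartition {E : Type*} [MeasurableSpace E] {k : ℕ}
    (A : Fin k → Set E) : Prop where
  measurableSet : ∀ i, MeasurableSet (A i)
  disjoint : ∀ i i', i ≠ i' → Disjoint (A i) (A i')
  cover : ⋃ i, A i = Set.univ

/-- `P` is a random probability measure on `E` (measures carry the `σ`-algebra generated by the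
evaluations at measurable sets). -/
structure IsRandomProbability {Ω E : Type*} [MeasurableSpace Ω] [MeasurableSpace E]
    (P : Ω → Measure E) : Prop where
  measurable : Measurable P
  isProbabilityMeasure : ∀ ω, IsProbabilityMeasure (P ω)

/-- `P ∼ DP(θ, G)`: for every finite measurable partition `A₁, …, Aₖ`, the vector
`(P(A₁), …, P(Aₖ))` has the Dirichlet distribution with parameters `θ G(A₁), …, θ G(Aₖ)`. -/
structure IsDirichletProcess {Ω E : Type*} [MeasurableSpace Ω] [MeasurableSpace E]
    (θ : ℝ) (G : Measure E) (μ : Measure Ω) (P : Ω → Measure E) : Prop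
    extends IsRandomProbability P where
  law : ∀ (k : ℕ) (A : Fin k → Set E), IsMeasurablePartition A →
    μ.map (fun ω a => (P ω).real (A a)) = dirichletMeasure (fun a => θ * G.real (A a))

/-- `(P₁, …, P_d) ∼ H-DP(θ, θ₀, P₀)` with root `R`: `R ∼ DP(θ₀, P₀)` and, conditionally on `R`,
the `Pⱼ` are i.i.d. `DP(θ, R)`. -/
structure IsHDP {Ω E : Type*} [MeasurableSpace Ω] [MeasurableSpace E] {d : ℕ}
    (θ θ₀ : ℝ) (P₀ : Measure E) (μ : Measure Ω)
    (R : Ω → Measure E) (P : Fin d → Ω → Measure E) : Prop where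
  root : IsDirichletProcess θ₀ P₀ μ R
  random : ∀ j, IsRandomProbability (P j)
  conditional_law : ∀ (k : ℕ) (A : Fin k → Set E), IsMeasurablePartition A →
    ∀ C : Fin d → Set (Fin k → ℝ), (∀ j, MeasurableSet (C j)) →
      μ⟦⋂ j, {ω | (fun a => (P j ω).real (A a)) ∈ C j} | MeasurableSpace.comap R inferInstance⟧
        =ᵐ[μ] fun ω => ∏ j, (dirichletMeasure fun a => θ * (R ω).real (A a)).real (C j)

/-- Conditionally on the `σ`-algebra `m`, the variables `ξᵢ` are independent with `ξᵢ ∼ Rᵢ`. -/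
structure IsConditionalSample {Ω E ι : Type*} (m : MeasurableSpace Ω) [mΩ : MeasurableSpace Ω]
    [MeasurableSpace E] (μ : Measure[mΩ] Ω) (R : ι → Ω → Measure E) (ξ : ι → Ω → E) : Prop where
  measurable : ∀ i, Measurable[mΩ] (ξ i)
  conditional_law : ∀ (S : Finset ι) (A : ι → Set E), (∀ i, MeasurableSet (A i)) →
    μ⟦⋂ i ∈ S, ξ i ⁻¹' A i | m⟧ =ᵐ[μ] fun ω => ∏ i ∈ S, (R i ω).real (A i)

/-! ### Nodes, layers, and labels in order of appearance -/

/-- The nodes `(j, i)`, `i ∈ [V_j]`, stacked layer after layer (lexicographic order). -/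
abbrev Node {d : ℕ} (V : Fin d → ℕ) : Type := Σₗ j : Fin d, Fin (V j)

/-- The layer of a node. -/
def layer {d : ℕ} {V : Fin d → ℕ} (u : Node V) : Fin d := (ofLex u).1

/-- The nodes of layer `j`. -/
def layerNodes {d : ℕ} (V : Fin d → ℕ) (j : Fin d) : Finset (Node V) :=
  Finset.univ.filter fun u => layer u = j

open Classical in
/-- The label in `{1, 2, …}` of the value `x i`, when the distinct values of `x` on `s` are
labelled in order of appearance: one plus the number of distinct values on `s` that appear
before `x i` does (`k` runs over the places in `s` where a value appears for the first time). If
`x i` does not appear on `s`, it is the number of distinct values on `s`, plus one. -/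
def label {ι α : Type*} [LinearOrder ι] (s : Finset ι) (x : ι → α) (i : ι) : ℕ :=
  1 + (s.filter fun k =>
    (∀ k' ∈ s, k' < k → x k' ≠ x k) ∧ ∀ i' ∈ s, x i' = x i → k < i').card

/-- The allocation vector `z` induced by the ties of the array `x`. -/
def allocation {d : ℕ} {V : Fin d → ℕ} {E : Type*} (x : Node V → E) (u : Node V) : ℕ :=
  label Finset.univ x u

/-- The within-layer subgroup labels `w` induced by the ties in each row of the array `t`. -/
def subgroups {d : ℕ} {V : Fin d → ℕ} {T : Type*} (t : Node V → T) (u : Node V) : ℕ :=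
  label (layerNodes V (layer u)) t u

/-- The array `x` that gives each node the sociability profile of its subgroup:
`x_{ji} = s_{jτ}` if `w_{ji} = τ`. -/
def profiles {d : ℕ} {V : Fin d → ℕ} {T E : Type*}
    (t : Node V → T) (s : Fin d × ℕ → E) (u : Node V) : E :=
  s (layer u, subgroups t u)

/-! ### The generative construction -/

/-- The joint construction of subgroups and sociability profiles: `Q₁, …, Q_d, R` are independent
with `Qⱼ ∼ DP(θ, Gⱼ)` and `R ∼ DP(θ₀, P₀)`; given these, the subgroup variables `t_{ji}` are
independent with `t_{ji} ∼ Qⱼ`; given all of the former, the profiles `s_{jτ}` of the subgroups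
`τ = 1, 2, …` of the layers `j` are i.i.d. from `R`. -/
structure IsFranchise {Ω E T : Type*} [MeasurableSpace Ω] [MeasurableSpace E] [MeasurableSpace T]
    {d : ℕ} (V : Fin d → ℕ) (θ θ₀ : ℝ) (P₀ : Measure E) (G : Fin d → Measure T) (μ : Measure Ω)
    (R : Ω → Measure E) (Q : Fin d → Ω → Measure T)
    (t : Node V → Ω → T) (s : Fin d × ℕ → Ω → E) : Prop where
  root : IsDirichletProcess θ₀ P₀ μ R
  layers : ∀ j, IsDirichletProcess θ (G j) μ (Q j)
  indep_layers : iIndepFun Q μ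
  indep_root : IndepFun R (fun ω j => Q j ω) μ
  sample_subgroups : IsConditionalSample
    (MeasurableSpace.comap (fun ω => (R ω, fun j => Q j ω)) inferInstance) μ
    (fun u => Q (layer u)) t
  sample_profiles : IsConditionalSample
    (MeasurableSpace.comap (fun ω => (R ω, (fun j => Q j ω), fun u => t u ω)) inferInstance) μ
    (fun _ => R) s

/-! ### Removing a node -/

/-- The nodes other than `v`. -/
abbrev Rest {d : ℕ} {V : Fin d → ℕ} (v : Node V) : Type := {u : Node V // u ≠ v}

/-- `z^{-v}`: `z` without node `v`, relabelled in order of appearance. -/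
def removeAllocation {d : ℕ} {V : Fin d → ℕ} (v : Node V) (z : Node V → ℕ) (u : Rest v) : ℕ :=
  label (Finset.univ.erase v) z u

/-- `w^{-v}`: `w` without node `v`, relabelled in order of appearance within each layer. -/
def removeSubgroups {d : ℕ} {V : Fin d → ℕ} (v : Node V) (w : Node V → ℕ) (u : Rest v) : ℕ :=
  label ((layerNodes V (layer u.1)).erase v) w u

/-- The profile of node `v` in terms of the labels of `z^{-v}`: it is `h ≤ H^{-v}` if `v` is in the
cluster with label `h` in `z^{-v}`, and `H^{-v} + 1` if no other node is in the cluster of `v`. -/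
def assigned {d : ℕ} {V : Fin d → ℕ} (v : Node V) (z : Node V → ℕ) : ℕ :=
  label (Finset.univ.erase v) z v

/-- `H^{-v}`, the number of clusters in `ζ = z^{-v}`. -/
def numClusters {d : ℕ} {V : Fin d → ℕ} {v : Node V} (ζ : Rest v → ℕ) : ℕ :=
  (Finset.univ.image ζ).card

/-- `n_{jh}^{-v}`, the number of nodes other than `v` in layer `j` with profile `h`. -/
def nodeCount {d : ℕ} {V : Fin d → ℕ} {v : Node V} (ζ : Rest v → ℕ) (j : Fin d) (h : ℕ) : ℕ :=
  (Finset.univ.filter fun u : Rest v => layer u.1 = j ∧ ζ u = h).card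

/-- `ℓ_{jh}^{-v}`, the number of subgroups in layer `j` with profile `h`, without node `v`. -/
def subgroupCount {d : ℕ} {V : Fin d → ℕ} {v : Node V} (ζ η : Rest v → ℕ)
    (j : Fin d) (h : ℕ) : ℕ :=
  ((Finset.univ.filter fun u : Rest v => layer u.1 = j ∧ ζ u = h).image η).card

/-- `ℓ_{·h}^{-v}`, the total number of subgroups with profile `h`, without node `v`. -/
def subgroupsWith {d : ℕ} {V : Fin d → ℕ} {v : Node V} (ζ η : Rest v → ℕ) (h : ℕ) : ℕ :=
  ∑ j, subgroupCount ζ η j h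

/-- `|ℓ^{-v}|`, the total number of subgroups, without node `v`. -/
def subgroupsTotal {d : ℕ} {V : Fin d → ℕ} {v : Node V} (ζ η : Rest v → ℕ) : ℕ :=
  ∑ j, ∑ h ∈ Finset.Icc 1 (numClusters ζ), subgroupCount ζ η j h

end

end PExP

open PExP

namespace PExP

/-! Everything rests on the Pólya urn in integrated form. Dirichlet moments are ratios of rising
factorials, so raising one exponent by one multiplies a moment by `(aᵢ + nᵢ) / (θ + ∑ n)`. Extended
by linearity, this says that a further draw from a Dirichlet process is a fresh draw from the base
measure with weight `θ`, or a copy of an earlier draw of the same layer with weight `1` each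
(`IsCondDirichlet.moment_step`). For fixed base measures it becomes the identity `IsUrn` for the law
of a sample.

When the layers share a random base `R`, the same recursion is satisfied by the following scheme:
run an urn with diffuse bases on another space, then draw one value from `R` for each block of ties
(`IsCondDirichlet.lintegral_prod_eq_blockProd`). The draws from `R` may be indexed by the nodes
themselves, each subgroup using the draw at a representative node (`joinProfiles`). Hence the pair
of subgroup variables and profiles, as well as any array sampled from the hierarchical process, is
read off from a product measure: the law of the subgroup variables times a root sample
(`IsFranchise.map_eq`, `IsHDP.map_eq`).

For (i), fix the subgroup variables. The clusters then depend only on the ties among the root draws,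
and the law of these ties depends on `θ₀` alone as long as the base is diffuse
(`IsUrn.measure_eq_of_ker`).

For (ii), choose the representatives among the nodes other than `v`, so that the root draw at `v`
matters only if `v` is alone in its subgroup. By the layer urn, `v` joins the subgroup of each other
node of its layer with weight `1`, which yields `n_{jh}`, or is alone with weight `θ`. In the latter
case the root urn, run over the representatives of the other subgroups, gives a new profile with
weight `θ₀` and the profile of each subgroup with weight `1`, which yields `ℓ_{·h}`
(`IsUrn.measure_new_subgroup`, `IsUrn.measure_assignedEvent`). -/

/-! ### Dirichlet moments from gamma integrals -/

/-- The rising factorial `a (a + 1) ⋯ (a + n - 1)`. -/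
noncomputable def rising (a : ℝ≥0∞) (n : ℕ) : ℝ≥0∞ := ∏ i ∈ Finset.range n, (a + i)

theorem rising_zero (a : ℝ≥0∞) : rising a 0 = 1 := by simp [rising]

theorem rising_succ (a : ℝ≥0∞) (n : ℕ) : rising a (n + 1) = rising a n * (a + n) := by
  simp [rising, Finset.prod_range_succ]

theorem rising_ne_zero {a : ℝ≥0∞} (ha : a ≠ 0) (n : ℕ) : rising a n ≠ 0 := by
  simp [rising, Finset.prod_ne_zero_iff, ha]

theorem rising_ne_top {a : ℝ≥0∞} (ha : a ≠ ∞) (n : ℕ) : rising a n ≠ ∞ := by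
  refine ENNReal.prod_ne_top fun i _ => by simp [ha]

theorem rising_ofReal {a : ℝ} (ha : 0 < a) (n : ℕ) :
    rising (ENNReal.ofReal a) n = ENNReal.ofReal (Real.Gamma (a + n) / Real.Gamma a) := by
  have h0 := Real.Gamma_pos_of_pos ha
  induction n with
  | zero => simp [rising_zero, h0.ne']
  | succ n ih =>
    have h1 : (0 : ℝ) < a + n := by positivity
    rw [rising_succ, ih, ← ENNReal.ofReal_natCast, ← ENNReal.ofReal_add ha.le (by positivity),
      ← ENNReal.ofReal_mul (div_nonneg (Real.Gamma_pos_of_pos h1).le h0.le)]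
    congr 1
    push_cast
    rw [← add_assoc, Real.Gamma_add_one h1.ne']
    ring

instance isProbabilityMeasure_unitGamma (a : ℝ) : IsProbabilityMeasure (unitGamma a) := by
  unfold unitGamma
  split_ifs with h
  · exact isProbabilityMeasure_gammaMeasure h one_pos
  · infer_instance

theorem measurable_gammaPDF (a r : ℝ) : Measurable (gammaPDF a r) :=
  (measurable_gammaPDFReal a r).ennreal_ofReal

/-- Multiplying the Gamma(`a`, 1) density by `xⁿ exp(-c x)` gives a multiple of the Gamma(`a + n`,
`1 + c`) density. At shape `0` both sides vanish for `n > 0` and equal `1` for `n = 0`. -/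
theorem lintegral_unitGamma {a : ℝ} (ha : 0 ≤ a) (n : ℕ) {c : ℝ} (hc : 0 ≤ c) :
    ∫⁻ x, ENNReal.ofReal x ^ n * ENNReal.ofReal (Real.exp (-(c * x))) ∂unitGamma a =
      rising (ENNReal.ofReal a) n * ENNReal.ofReal ((1 + c) ^ (-(a + n))) := by
  have hm : Measurable fun x : ℝ =>
      ENNReal.ofReal x ^ n * ENNReal.ofReal (Real.exp (-(c * x))) := by fun_prop
  rcases ha.eq_or_lt with rfl | ha
  · simp only [unitGamma, lt_irrefl, if_false]
    rw [lintegral_dirac' _ hm]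
    cases n with
    | zero => simp [rising_zero]
    | succ n =>
      have : rising (ENNReal.ofReal 0) (n + 1) = 0 := by
        simp [rising, Finset.prod_range_succ']
      rw [this]; simp
  · have han : (0 : ℝ) < a + n := by positivity
    rw [unitGamma, if_pos ha, gammaMeasure, lintegral_withDensity_eq_lintegral_mul _
      (measurable_gammaPDF _ _) hm, rising_ofReal ha, ← ENNReal.ofReal_mul
        (div_nonneg (Real.Gamma_pos_of_pos han).le (Real.Gamma_pos_of_pos ha).le)]
    -- The factor `1` becomes the total mass of the Gamma(`a + n`, `1 + c`) density; the two
    -- integrands then agree away from `x = 0`.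
    rw [← mul_one (ENNReal.ofReal _), ← lintegral_gammaPDF_eq_one han (r := 1 + c) (by linarith),
      ← lintegral_const_mul _ (measurable_gammaPDF _ _)]
    refine lintegral_congr_ae ?_
    have h0 : ∀ᵐ x : ℝ, x ≠ 0 := by simp [ae_iff]
    filter_upwards [h0] with x hx
    rcases lt_or_gt_of_ne hx with hx | hx
    · simp [gammaPDF_of_neg hx]
    · have hG := Real.Gamma_pos_of_pos ha
      have hG' := Real.Gamma_pos_of_pos han
      have hc1 : (0 : ℝ) < 1 + c := by linarith
      rw [Pi.mul_apply, gammaPDF_of_nonneg hx.le, gammaPDF_of_nonneg hx.le,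
        ← ENNReal.ofReal_pow hx.le, ← ENNReal.ofReal_mul (by positivity),
        ← ENNReal.ofReal_mul (by positivity), ← ENNReal.ofReal_mul (by positivity)]
      congr 1
      have e1 : x ^ (a + n - 1) = x ^ (a - 1) * x ^ n := by
        rw [← Real.rpow_natCast, ← Real.rpow_add hx]; congr 1; ring
      have e2 : Real.exp (-((1 + c) * x)) = Real.exp (-(1 * x)) * Real.exp (-(c * x)) := by
        rw [← Real.exp_add]; congr 1; ring
      rw [e1, e2, Real.rpow_neg hc1.le, Real.one_rpow]
      have := (Real.rpow_pos_of_pos hc1 (a + n)).ne'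
      field_simp

theorem lintegral_pi_prod {ι : Type*} [Fintype ι] {X : ι → Type*} [∀ i, MeasurableSpace (X i)]
    (μ : ∀ i, Measure (X i)) [∀ i, IsProbabilityMeasure (μ i)] (f : ∀ i, X i → ℝ≥0∞)
    (hf : ∀ i, Measurable (f i)) :
    ∫⁻ x, ∏ i, f i (x i) ∂Measure.pi μ = ∏ i, ∫⁻ y, f i y ∂μ i := by
  rw [lintegral_prod_eq_prod_lintegral_of_indepFun Finset.univ (fun i (x : ∀ i, X i) => f i (x i))
    (iIndepFun_pi fun i => (hf i).aemeasurable)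
    (fun i => (hf i).comp (measurable_pi_apply i))]
  refine Finset.prod_congr rfl fun i _ => ?_
  exact (measurePreserving_eval μ i).lintegral_comp (hf i)

theorem ofReal_Gamma_mul_pow {N : ℕ} (hN : 0 < N) {s : ℝ} (hs : 0 < s) :
    ∫⁻ c in Set.Ioi (0 : ℝ), ENNReal.ofReal (c ^ ((N : ℝ) - 1) * Real.exp (-(s * c))) =
      ENNReal.ofReal (Real.Gamma N) * ENNReal.ofReal (s⁻¹) ^ N := by
  have hN' : (0 : ℝ) < N := by exact_mod_cast hN
  rw [← ofReal_integral_eq_lintegral_ofReal]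
  · rw [Real.integral_rpow_mul_exp_neg_mul_Ioi hN' hs, mul_comm,
      ENNReal.ofReal_mul (Real.Gamma_pos_of_pos hN').le, ← ENNReal.ofReal_pow (by positivity),
      Real.rpow_natCast, one_div]
  -- Without integrability the Bochner integral would be `0`, while its closed form is positive.
  · by_contra h
    have := Real.integral_rpow_mul_exp_neg_mul_Ioi hN' hs
    rw [integral_undef h] at this
    have h1 := Real.Gamma_pos_of_pos hN'
    have : (0 : ℝ) < (1 / s) ^ (N : ℝ) * Real.Gamma N := by positivity
    linarith
  · refine (ae_restrict_iff' measurableSet_Ioi).2 (ae_of_all _ fun c (hc : 0 < c) => ?_)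
    positivity

instance isProbabilityMeasure_dirichletMeasure {k : ℕ} (a : Fin k → ℝ) :
    IsProbabilityMeasure (dirichletMeasure a) :=
  Measure.isProbabilityMeasure_map (by fun_prop)

theorem ae_pos_unitGamma {a : ℝ} (ha : 0 < a) : ∀ᵐ x ∂unitGamma a, 0 < x := by
  rw [unitGamma, if_pos ha, gammaMeasure,
    ae_withDensity_iff (measurable_gammaPDF _ _)]
  have h0 : ∀ᵐ x : ℝ, x ≠ 0 := by simp [ae_iff]
  filter_upwards [h0] with x hx h
  rcases lt_or_gt_of_ne hx with hx | hx
  · exact absurd (gammaPDF_of_neg hx) h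
  · exact hx

theorem ae_nonneg_unitGamma (a : ℝ) : ∀ᵐ x ∂unitGamma a, 0 ≤ x := by
  by_cases ha : 0 < a
  · exact (ae_pos_unitGamma ha).mono fun x hx => hx.le
  · rw [unitGamma, if_neg ha, ae_dirac_iff measurableSet_Ici]

/-- The normalising power `(∑ g)⁻ᴺ` is written as a gamma integral in `c`; after Tonelli the
coordinates separate. The remaining integral in `c` depends only on the sums of the parameters and
of the exponents, so it need not be evaluated. -/
theorem Gamma_mul_dirichlet_moment {k : ℕ} {a : Fin k → ℝ} (ha : ∀ i, 0 ≤ a i)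
    (hA : 0 < ∑ i, a i) (n : Fin k → ℕ) (hn : 0 < ∑ i, n i) :
    ENNReal.ofReal (Real.Gamma (∑ i, n i : ℕ)) *
        ∫⁻ x, ∏ i, ENNReal.ofReal (x i) ^ n i ∂dirichletMeasure a =
      (∏ i, rising (ENNReal.ofReal (a i)) (n i)) *
        ∫⁻ c in Set.Ioi (0 : ℝ), ENNReal.ofReal (c ^ (((∑ i, n i : ℕ) : ℝ) - 1)) *
          ENNReal.ofReal ((1 + c) ^ (-(∑ i, a i + (∑ i, n i : ℕ)))) := by
  set N := ∑ i, n i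
  -- One positive parameter suffices for the normalising sum to be almost surely positive.
  have hpos : ∃ i, 0 < a i := by
    by_contra! h
    exact absurd hA (not_lt.2 (Finset.sum_nonpos fun i _ => h i))
  obtain ⟨i₀, hi₀⟩ := hpos
  have hae0 : ∀ᵐ g ∂Measure.pi fun i => unitGamma (a i), ∀ i, 0 ≤ g i := by
    rw [ae_all_iff]
    intro i
    exact (measurePreserving_eval (fun i => unitGamma (a i)) i).quasiMeasurePreserving.ae
      (ae_nonneg_unitGamma (a i))
  have hae1 : ∀ᵐ g ∂Measure.pi fun i => unitGamma (a i), 0 < g i₀ :=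
    (measurePreserving_eval (fun i => unitGamma (a i)) i₀).quasiMeasurePreserving.ae
      (ae_pos_unitGamma hi₀)
  rw [dirichletMeasure, lintegral_map (by fun_prop) (by fun_prop),
    ← lintegral_const_mul _ (by fun_prop)]
  have step : ∀ᵐ g ∂Measure.pi fun i => unitGamma (a i),
      ENNReal.ofReal (Real.Gamma N) * ∏ i, ENNReal.ofReal (g i / ∑ l, g l) ^ n i =
      ∫⁻ c in Set.Ioi (0 : ℝ), ENNReal.ofReal (c ^ ((N : ℝ) - 1)) *
        ∏ i, (ENNReal.ofReal (g i) ^ n i * ENNReal.ofReal (Real.exp (-(c * g i)))) := by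
    filter_upwards [hae0, hae1] with g h0 h1
    have hS : 0 < ∑ l, g l := Finset.sum_pos' (fun i _ => h0 i) ⟨i₀, Finset.mem_univ _, h1⟩
    have : ∀ i, ENNReal.ofReal (g i / ∑ l, g l) ^ n i =
        ENNReal.ofReal (g i) ^ n i * ENNReal.ofReal ((∑ l, g l)⁻¹) ^ n i := fun i => by
      rw [div_eq_mul_inv, ENNReal.ofReal_mul (h0 i), mul_pow]
    simp_rw [this]
    rw [Finset.prod_mul_distrib, Finset.prod_pow_eq_pow_sum, mul_left_comm,
      ← ofReal_Gamma_mul_pow hn hS, ← lintegral_const_mul _ (by fun_prop)]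
    refine setLIntegral_congr_fun measurableSet_Ioi fun c (hc : 0 < c) => ?_
    rw [Finset.prod_mul_distrib, ← ENNReal.ofReal_prod_of_nonneg (fun i _ => (Real.exp_pos _).le),
      ← Real.exp_sum, ENNReal.ofReal_mul (by positivity), Finset.sum_neg_distrib, ← Finset.mul_sum,
      mul_comm c]
    ring
  rw [lintegral_congr_ae step, lintegral_lintegral_swap (by fun_prop),
    ← lintegral_const_mul _ (by fun_prop)]
  refine setLIntegral_congr_fun measurableSet_Ioi fun c (hc : 0 < c) => ?_
  rw [lintegral_const_mul _ (by fun_prop), lintegral_pi_prod (fun i => unitGamma (a i))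
    (fun i x => ENNReal.ofReal x ^ n i * ENNReal.ofReal (Real.exp (-(c * x)))) (by fun_prop)]
  simp_rw [fun i => lintegral_unitGamma (ha i) (n i) hc.le]
  rw [Finset.prod_mul_distrib, ← ENNReal.ofReal_prod_of_nonneg (fun i _ => by positivity),
    ← Real.rpow_sum_of_pos (by positivity), Finset.sum_neg_distrib, Finset.sum_add_distrib,
    ← Nat.cast_sum]
  ring

theorem lintegral_dirichletMeasure {k : ℕ} {a : Fin k → ℝ} (ha : ∀ i, 0 ≤ a i)
    (hA : 0 < ∑ i, a i) (n : Fin k → ℕ) :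
    rising (ENNReal.ofReal (∑ i, a i)) (∑ i, n i) *
        ∫⁻ x, ∏ i, ENNReal.ofReal (x i) ^ n i ∂dirichletMeasure a =
      ∏ i, rising (ENNReal.ofReal (a i)) (n i) := by
  rcases Nat.eq_zero_or_pos (∑ i, n i) with h0 | hN
  · have : ∀ i, n i = 0 := fun i => (Finset.sum_eq_zero_iff.1 h0) i (Finset.mem_univ i)
    simp [this, rising_zero]
  · have h1 := Gamma_mul_dirichlet_moment ha hA n hN
    -- The case `k = 1` with the same sums has the same integral in `c`, and there the Dirichlet
    -- vector is almost surely `1`; this evaluates the integral.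
    have h2 := Gamma_mul_dirichlet_moment (k := 1) (a := fun _ => ∑ i, a i) (fun _ => hA.le)
      (by simpa using hA) (fun _ => ∑ i, n i) (by simpa using hN)
    have h3 : ∫⁻ x, ∏ i, ENNReal.ofReal (x i) ^ (∑ i, n i)
        ∂dirichletMeasure (fun _ : Fin 1 => ∑ i, a i) = 1 := by
      rw [dirichletMeasure, lintegral_map (by fun_prop) (by fun_prop)]
      rw [← measure_univ (μ := Measure.pi fun _ : Fin 1 => unitGamma (∑ i, a i)),
        ← lintegral_one]
      refine lintegral_congr_ae ?_
      have := (measurePreserving_eval (fun _ : Fin 1 => unitGamma (∑ i, a i))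
        0).quasiMeasurePreserving.ae (ae_pos_unitGamma hA)
      filter_upwards [this] with g hg
      simp only [Function.eval] at hg
      simp [div_self hg.ne']
    simp only [Finset.univ_unique, Finset.sum_singleton, Finset.prod_singleton] at h2 h3
    rw [h3, mul_one] at h2
    have hc : Real.Gamma (∑ i, n i : ℕ) > 0 := Real.Gamma_pos_of_pos (by exact_mod_cast hN)
    rw [← ENNReal.mul_right_inj (a := ENNReal.ofReal (Real.Gamma (∑ i, n i : ℕ)))
      (by simpa using hc) ENNReal.ofReal_ne_top, mul_left_comm, h1, mul_left_comm, ← h2, mul_comm]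

/-- This and the next two results make the Dirichlet law with random parameters a kernel. -/
theorem measurable_measure_pi {ι α : Type*} [Fintype ι] [MeasurableSpace α] {X : ι → Type*}
    [∀ i, MeasurableSpace (X i)] {m : ∀ i, α → Measure (X i)}
    [∀ i a, IsProbabilityMeasure (m i a)] (hm : ∀ i, Measurable (m i)) :
    Measurable fun a => Measure.pi fun i => m i a := by
  refine Measurable.measure_of_isPiSystem_of_isProbabilityMeasure generateFrom_pi.symm
    isPiSystem_pi ?_
  rintro _ ⟨s, hs, rfl⟩
  simp only [Measure.pi_pi]
  refine Finset.measurable_prod _ fun i _ => ?_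
  exact Measure.measurable_measure.1 (hm i) _ (hs i (Set.mem_univ i))

theorem measurable_unitGamma : Measurable unitGamma := by
  -- `Real.Gamma` is continuous on the positive half-line; the value `1` elsewhere only serves to
  -- make a measurable function on all of `ℝ`.
  have hG : Measurable fun a : ℝ => if 0 < a then Real.Gamma a else 1 := by
    have : ContinuousOn Real.Gamma (Set.Ioi 0) :=
      Real.differentiableOn_Gamma_Ioi.continuousOn
    exact this.measurable_piecewise continuousOn_const measurableSet_Ioi
  refine Measure.measurable_of_measurable_coe _ fun s hs => ?_
  have : (fun a => unitGamma a s) = fun a => if 0 < a then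
      ∫⁻ x in s, ENNReal.ofReal (if 0 ≤ x then 1 / (if 0 < a then Real.Gamma a else 1) *
        x ^ (a - 1) * Real.exp (-x) else 0) else Measure.dirac 0 s := by
    ext a
    split_ifs with ha
    · simp [unitGamma, if_pos ha, gammaMeasure, withDensity_apply _ hs, gammaPDF, gammaPDFReal]
    · simp [unitGamma, if_neg ha]
  rw [this]
  refine Measurable.ite measurableSet_Ioi ?_ measurable_const
  refine Measurable.lintegral_prod_right' (f := fun p : ℝ × ℝ => ENNReal.ofReal (if 0 ≤ p.2 then
    1 / (if 0 < p.1 then Real.Gamma p.1 else 1) * p.2 ^ (p.1 - 1) * Real.exp (-p.2) else 0)) ?_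
  refine Measurable.ennreal_ofReal (Measurable.ite (measurableSet_le (by fun_prop) (by fun_prop))
    ?_ measurable_const)
  have h1 := hG.comp (measurable_fst : Measurable (Prod.fst : ℝ × ℝ → ℝ))
  simp only [Function.comp_def] at h1
  fun_prop

theorem measurable_dirichletMeasure {k : ℕ} :
    Measurable (dirichletMeasure : (Fin k → ℝ) → Measure (Fin k → ℝ)) := by
  refine (Measure.measurable_map _ (by fun_prop)).comp ?_
  exact measurable_measure_pi fun i => measurable_unitGamma.comp (measurable_pi_apply i)

/-! ### The urn recursion for products of linear forms in Dirichlet vectors -/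

section Multilinear

variable {ι J : Type*} [Fintype ι] [Fintype J] [DecidableEq J] {k : ℕ}

/-- Compare the moment formula for `n` and for `n` raised by one at `i₀`: each side gains a single
rising-factorial factor. -/
theorem dirichlet_moment_step {a : Fin k → ℝ} (ha : ∀ i, 0 ≤ a i) (hA : 0 < ∑ i, a i)
    (n : Fin k → ℕ) (i₀ : Fin k) :
    (ENNReal.ofReal (∑ i, a i) + (∑ i, n i : ℕ)) * ∫⁻ x, ENNReal.ofReal (x i₀) *
        ∏ i, ENNReal.ofReal (x i) ^ n i ∂dirichletMeasure a =
      (ENNReal.ofReal (a i₀) + n i₀) *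
        ∫⁻ x, ∏ i, ENNReal.ofReal (x i) ^ n i ∂dirichletMeasure a := by
  have h1 := lintegral_dirichletMeasure ha hA n
  have h2 := lintegral_dirichletMeasure ha hA (fun i => n i + if i = i₀ then 1 else 0)
  have e1 : ∀ x : Fin k → ℝ, ∏ i, ENNReal.ofReal (x i) ^ (n i + if i = i₀ then 1 else 0) =
      ENNReal.ofReal (x i₀) * ∏ i, ENNReal.ofReal (x i) ^ n i := fun x => by
    simp_rw [pow_add]
    rw [Finset.prod_mul_distrib, mul_comm]
    congr 1
    simp [pow_ite]
  have e2 : ∏ i, rising (ENNReal.ofReal (a i)) (n i + if i = i₀ then 1 else 0) =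
      (∏ i, rising (ENNReal.ofReal (a i)) (n i)) * (ENNReal.ofReal (a i₀) + n i₀) := by
    have : ∀ i, rising (ENNReal.ofReal (a i)) (n i + if i = i₀ then 1 else 0) =
        rising (ENNReal.ofReal (a i)) (n i) *
          if i = i₀ then ENNReal.ofReal (a i) + n i else 1 := fun i => by
      split_ifs
      · rw [rising_succ]
      · simp
    simp_rw [this]
    rw [Finset.prod_mul_distrib, Finset.prod_ite_eq' Finset.univ i₀, if_pos (Finset.mem_univ _)]
  simp_rw [e1] at h2
  rw [e2, ← h1, Finset.sum_add_distrib, Finset.sum_ite_eq' Finset.univ i₀,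
    if_pos (Finset.mem_univ _), rising_succ, mul_assoc, mul_assoc] at h2
  have hr : ENNReal.ofReal (∑ i, a i) ≠ 0 := by simpa using hA
  rw [ENNReal.mul_right_inj (rising_ne_zero hr _) (rising_ne_top ENNReal.ofReal_ne_top _)] at h2
  rw [h2, mul_comm]

theorem prod_coords_eq (l : ι → J) (c : ι → Fin k) (y : J → Fin k → ℝ≥0∞) :
    ∏ u, y (l u) (c u) =
      ∏ j, ∏ i, y j i ^ (Finset.univ.filter fun u => l u = j ∧ c u = i).card := by
  have := Finset.prod_comp (s := Finset.univ) (fun p : J × Fin k => y p.1 p.2)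
    (fun u : ι => (l u, c u))
  rw [this, ← Fintype.prod_prod_type (fun p : J × Fin k =>
    y p.1 p.2 ^ (Finset.univ.filter fun u => l u = p.1 ∧ c u = p.2).card)]
  simp_rw [Prod.ext_iff]
  refine Finset.prod_subset (Finset.subset_univ _) fun p _ hp => ?_
  have : (Finset.univ.filter fun u => l u = p.1 ∧ c u = p.2) = ∅ := by
    refine Finset.filter_eq_empty_iff.2 fun u _ h => hp ?_
    exact Finset.mem_image.2 ⟨u, Finset.mem_univ _, Prod.ext h.1 h.2⟩
  simp [this]

theorem monomial_step {θ : ℝ} (hθ : 0 < θ) {a : J → Fin k → ℝ} (ha : ∀ j i, 0 ≤ a j i)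
    (hA : ∀ j, ∑ i, a j i = θ) (l : ι → J) (c : ι → Fin k) (j₀ : J) (i₀ : Fin k) :
    (ENNReal.ofReal θ + ((Finset.univ.filter fun u => l u = j₀).card : ℝ≥0∞)) *
      ∫⁻ x, ENNReal.ofReal (x j₀ i₀) * ∏ u, ENNReal.ofReal (x (l u) (c u))
        ∂(Measure.pi fun j => dirichletMeasure (a j)) =
    (ENNReal.ofReal (a j₀ i₀) + ((Finset.univ.filter fun u => l u = j₀ ∧ c u = i₀).card : ℝ≥0∞)) *
      ∫⁻ x, ∏ u, ENNReal.ofReal (x (l u) (c u))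
        ∂(Measure.pi fun j => dirichletMeasure (a j)) := by
  set n : J → Fin k → ℕ := fun j i => (Finset.univ.filter fun u => l u = j ∧ c u = i).card with hn
  have e0 : ∀ x : J → Fin k → ℝ, ∏ u, ENNReal.ofReal (x (l u) (c u)) =
      ∏ j, ∏ i, ENNReal.ofReal (x j i) ^ n j i := fun x =>
    prod_coords_eq l c fun j i => ENNReal.ofReal (x j i)
  have e1 : ∀ x : J → Fin k → ℝ, ENNReal.ofReal (x j₀ i₀) *
      ∏ u, ENNReal.ofReal (x (l u) (c u)) =
      ∏ j, (if j = j₀ then ENNReal.ofReal (x j i₀) else 1) *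
        ∏ i, ENNReal.ofReal (x j i) ^ n j i := fun x => by
    rw [e0, Finset.prod_mul_distrib, Finset.prod_ite_eq' Finset.univ j₀,
      if_pos (Finset.mem_univ _)]
  simp_rw [e1, e0]
  rw [lintegral_pi_prod (fun j => dirichletMeasure (a j))
      (fun j x => ∏ i, ENNReal.ofReal (x i) ^ n j i) (fun j => by fun_prop),
    lintegral_pi_prod (fun j => dirichletMeasure (a j))
      (fun j x => (if j = j₀ then ENNReal.ofReal (x i₀) else 1) *
        ∏ i, ENNReal.ofReal (x i) ^ n j i)
      (fun j => by split_ifs <;> fun_prop),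
    ← Finset.mul_prod_erase _ _ (Finset.mem_univ j₀),
    ← Finset.mul_prod_erase _ _ (Finset.mem_univ j₀), ← mul_assoc, ← mul_assoc]
  congr 1
  · have hc : (Finset.univ.filter fun u => l u = j₀).card = ∑ i, n j₀ i := by
      rw [Finset.card_eq_sum_card_fiberwise (f := c) (t := Finset.univ) (by simp)]
      simp [hn, Finset.filter_filter]
    simp only [if_true]
    rw [hc, ← hA j₀]
    exact dirichlet_moment_step (ha j₀) (by rw [hA]; exact hθ) (n j₀) i₀
  · refine Finset.prod_congr rfl fun j hj => ?_
    simp [(Finset.mem_erase.1 hj).1]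

/-- Expand the product into monomials, one for each choice `c` of coordinates, and use
`monomial_step`. The count of factors in layer `j₀` with `c u = i₀`, summed against `g`, turns into
a sum over single factors `u'`, each of which absorbs `g`: this is the copying term of the urn. -/
theorem multilinear_step_univ [DecidableEq ι] {θ : ℝ} (hθ : 0 < θ) {a : J → Fin k → ℝ}
    (ha : ∀ j i, 0 ≤ a j i)
    (hA : ∀ j, ∑ i, a j i = θ) (l : ι → J) (f : ι → Fin k → ℝ≥0∞) (j₀ : J)
    (g : Fin k → ℝ≥0∞) :
    (ENNReal.ofReal θ + ((Finset.univ.filter fun u => l u = j₀).card : ℝ≥0∞)) *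
      ∫⁻ x, (∑ i, g i * ENNReal.ofReal (x j₀ i)) * ∏ u, ∑ i, f u i * ENNReal.ofReal (x (l u) i)
        ∂(Measure.pi fun j => dirichletMeasure (a j)) =
    (∑ i, g i * ENNReal.ofReal (a j₀ i)) * ∫⁻ x, ∏ u, ∑ i, f u i * ENNReal.ofReal (x (l u) i)
        ∂(Measure.pi fun j => dirichletMeasure (a j)) +
      ∑ u' ∈ Finset.univ.filter (fun u => l u = j₀),
        ∫⁻ x, ∏ u, ∑ i, (f u i * if u = u' then g i else 1) * ENNReal.ofReal (x (l u) i)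
          ∂(Measure.pi fun j => dirichletMeasure (a j)) := by
  set M : (ι → Fin k) → ℝ≥0∞ := fun c => ∫⁻ x, ∏ u, ENNReal.ofReal (x (l u) (c u))
    ∂(Measure.pi fun j => dirichletMeasure (a j)) with hM
  have expand : ∀ f : ι → Fin k → ℝ≥0∞,
      ∫⁻ x, ∏ u, ∑ i, f u i * ENNReal.ofReal (x (l u) i)
        ∂(Measure.pi fun j => dirichletMeasure (a j)) = ∑ c, (∏ u, f u (c u)) * M c := by
    intro f
    simp_rw [Finset.prod_univ_sum, Fintype.piFinset_univ, Finset.prod_mul_distrib]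
    rw [lintegral_finsetSum _ fun c _ => by fun_prop]
    refine Finset.sum_congr rfl fun c _ => ?_
    rw [lintegral_const_mul _ (by fun_prop)]
  rw [expand, Finset.sum_congr rfl fun u' _ => expand _]
  have e1 : ∀ x : J → Fin k → ℝ, (∑ i, g i * ENNReal.ofReal (x j₀ i)) *
      ∏ u, ∑ i, f u i * ENNReal.ofReal (x (l u) i) =
      ∑ i, ∑ c : ι → Fin k, (g i * ∏ u, f u (c u)) *
        (ENNReal.ofReal (x j₀ i) * ∏ u, ENNReal.ofReal (x (l u) (c u))) := by
    intro x
    simp_rw [Finset.prod_univ_sum, Fintype.piFinset_univ, Finset.prod_mul_distrib,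
      Finset.sum_mul_sum]
    refine Finset.sum_congr rfl fun i _ => Finset.sum_congr rfl fun c _ => ?_
    ring
  simp_rw [e1]
  rw [lintegral_finsetSum _ fun c _ => by fun_prop]
  simp_rw [fun i => lintegral_finsetSum (μ := Measure.pi fun j => dirichletMeasure (a j))
    (Finset.univ : Finset (ι → Fin k)) (f := fun c (x : J → Fin k → ℝ) => (g i * ∏ u, f u (c u)) *
        (ENNReal.ofReal (x j₀ i) * ∏ u, ENNReal.ofReal (x (l u) (c u)))) (fun c _ => by fun_prop)]
  have e2 : ∀ (i : Fin k) (c : ι → Fin k), ∫⁻ x, (g i * ∏ u, f u (c u)) *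
        (ENNReal.ofReal (x j₀ i) * ∏ u, ENNReal.ofReal (x (l u) (c u)))
        ∂(Measure.pi fun j => dirichletMeasure (a j)) = (g i * ∏ u, f u (c u)) *
      ∫⁻ x, ENNReal.ofReal (x j₀ i) * ∏ u, ENNReal.ofReal (x (l u) (c u))
        ∂(Measure.pi fun j => dirichletMeasure (a j)) := fun i c =>
    lintegral_const_mul _ (by fun_prop)
  simp_rw [e2, Finset.mul_sum]
  have e3 : ∀ (i : Fin k) (c : ι → Fin k),
      (ENNReal.ofReal θ + ((Finset.univ.filter fun u => l u = j₀).card : ℝ≥0∞)) * ((g i * ∏ u, f u (c u)) *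
      ∫⁻ x, ENNReal.ofReal (x j₀ i) * ∏ u, ENNReal.ofReal (x (l u) (c u))
        ∂(Measure.pi fun j => dirichletMeasure (a j))) =
      (g i * ENNReal.ofReal (a j₀ i)) * ((∏ u, f u (c u)) * M c) +
      (g i * ((Finset.univ.filter fun u => l u = j₀ ∧ c u = i).card : ℝ≥0∞)) *
        ((∏ u, f u (c u)) * M c) := fun i c => by
    rw [mul_left_comm, monomial_step hθ ha hA l c j₀ i]
    ring
  simp_rw [e3, Finset.sum_add_distrib]
  rw [Finset.sum_comm]
  congr 1
  · simp_rw [← Finset.sum_mul]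
  · rw [Finset.sum_comm, Finset.sum_comm (s := Finset.univ.filter _)]
    refine Finset.sum_congr rfl fun c _ => ?_
    have e4 : ∀ u', ∏ u, (f u (c u) * if u = u' then g (c u) else 1) =
        (∏ u, f u (c u)) * g (c u') := fun u' => by
      rw [Finset.prod_mul_distrib, Finset.prod_ite_eq' Finset.univ u',
        if_pos (Finset.mem_univ _)]
    simp_rw [e4]
    have e5 : ∑ i, g i * ((Finset.univ.filter fun u => l u = j₀ ∧ c u = i).card : ℝ≥0∞) =
        ∑ u' ∈ Finset.univ.filter (fun u => l u = j₀), g (c u') := by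
      simp_rw [← Finset.filter_filter, Finset.card_filter, Nat.cast_sum, Finset.mul_sum]
      rw [Finset.sum_comm]
      refine Finset.sum_congr rfl fun u _ => ?_
      simp
    rw [← Finset.sum_mul, e5, Finset.sum_mul]
    refine Finset.sum_congr rfl fun u _ => ?_
    ring

theorem multilinear_step {ι : Type*} [DecidableEq ι] {θ : ℝ} (hθ : 0 < θ) {a : J → Fin k → ℝ} (ha : ∀ j i, 0 ≤ a j i)
    (hA : ∀ j, ∑ i, a j i = θ) (l : ι → J) (S : Finset ι) (f : ι → Fin k → ℝ≥0∞) (j₀ : J)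
    (g : Fin k → ℝ≥0∞) :
    (ENNReal.ofReal θ + ((S.filter fun u => l u = j₀).card : ℝ≥0∞)) *
      ∫⁻ x, (∑ i, g i * ENNReal.ofReal (x j₀ i)) * ∏ u ∈ S, ∑ i, f u i * ENNReal.ofReal (x (l u) i)
        ∂(Measure.pi fun j => dirichletMeasure (a j)) =
    (∑ i, g i * ENNReal.ofReal (a j₀ i)) * ∫⁻ x, ∏ u ∈ S, ∑ i, f u i * ENNReal.ofReal (x (l u) i)
        ∂(Measure.pi fun j => dirichletMeasure (a j)) +
      ∑ u' ∈ S.filter (fun u => l u = j₀),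
        ∫⁻ x, ∏ u ∈ S, ∑ i, (f u i * if u = u' then g i else 1) * ENNReal.ofReal (x (l u) i)
          ∂(Measure.pi fun j => dirichletMeasure (a j)) := by
  have h := multilinear_step_univ hθ ha hA (fun u : S => l u) (fun u => f u) j₀ g
  have hc : (Finset.univ.filter fun u : S => l u = j₀).card = (S.filter fun u => l u = j₀).card := by
    rw [Finset.card_filter, Finset.card_filter,
      Finset.sum_coe_sort S (fun u => if l u = j₀ then 1 else 0)]
  rw [hc] at h
  simp_rw [fun x : J → Fin k → ℝ =>
    Finset.prod_coe_sort S fun u => ∑ i, f u i * ENNReal.ofReal (x (l u) i)] at h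
  rw [h]
  congr 1
  rw [Finset.sum_filter, Finset.sum_filter, ← Finset.sum_coe_sort S]
  refine Finset.sum_congr rfl fun u' _ => ?_
  simp_rw [Subtype.ext_iff]
  simp_rw [fun x : J → Fin k → ℝ => Finset.prod_coe_sort S fun u =>
    ∑ i, (f u i * if u = u' then g i else 1) * ENNReal.ofReal (x (l u) i)]

end Multilinear

/-! ### Moments of conditionally independent Dirichlet processes -/

/-- Conditionally on the family of base measures `b`, the random probability measures `P j` are
independent with `P j ∼ DP(θ, b j)`. -/
structure IsCondDirichlet {Ω E J : Type*} [Fintype J] [MeasurableSpace Ω] [MeasurableSpace E]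
    (θ : ℝ) (b : J → Ω → Measure E) (μ : Measure Ω) (P : J → Ω → Measure E) : Prop where
  base : ∀ j, IsRandomProbability (b j)
  random : ∀ j, IsRandomProbability (P j)
  law : ∀ (k : ℕ) (A : Fin k → Set E), IsMeasurablePartition A →
    ∀ D : Set (J → Measure E), MeasurableSet D →
    ∀ C : J → Set (Fin k → ℝ), (∀ j, MeasurableSet (C j)) →
      μ ({ω | (fun j => b j ω) ∈ D} ∩ ⋂ j, {ω | (fun a => (P j ω).real (A a)) ∈ C j}) =
        ∫⁻ ω in {ω | (fun j => b j ω) ∈ D},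
          ∏ j, dirichletMeasure (fun a => θ * (b j ω).real (A a)) (C j) ∂μ

section Moments

variable {Ω E J : Type*} [Fintype J] [MeasurableSpace Ω] [MeasurableSpace E]

theorem IsRandomProbability.measurable_real {P : Ω → Measure E} (hP : IsRandomProbability P)
    {A : Set E} (hA : MeasurableSet A) : Measurable fun ω => (P ω).real A :=
  (Measure.measurable_measure.1 hP.measurable A hA).ennreal_toReal

theorem IsRandomProbability.measurable_apply {P : Ω → Measure E} (hP : IsRandomProbability P)
    {A : Set E} (hA : MeasurableSet A) : Measurable fun ω => P ω A :=
  Measure.measurable_measure.1 hP.measurable A hA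

theorem measurable_eval_measure {J : Type*} {A : Set E} (hA : MeasurableSet A) (j : J) :
    Measurable fun β : J → Measure E => β j A :=
  (Measure.measurable_coe hA).comp (measurable_pi_apply j)

/-- The defining law on rectangles fixes the joint law of the base measures and of the masses of a
partition: it is the law of the bases composed with a product Dirichlet kernel. -/
theorem IsCondDirichlet.lintegral_eq {θ : ℝ} {b P : J → Ω → Measure E} {μ : Measure Ω}
    [IsProbabilityMeasure μ] (h : IsCondDirichlet θ b μ P) {k : ℕ} {A : Fin k → Set E}
    (hA : IsMeasurablePartition A) {φ : (J → Measure E) → ℝ≥0∞} (hφ : Measurable φ)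
    {F : (J → Fin k → ℝ) → ℝ≥0∞} (hF : Measurable F) :
    ∫⁻ ω, φ (fun j => b j ω) * F (fun j a => (P j ω).real (A a)) ∂μ =
      ∫⁻ ω, φ (fun j => b j ω) *
        ∫⁻ x, F x ∂(Measure.pi fun j => dirichletMeasure fun a => θ * (b j ω).real (A a)) ∂μ := by
  have hb : Measurable fun ω j => b j ω := measurable_pi_iff.2 fun j => (h.base j).measurable
  have hv : Measurable fun ω => (fun j a => (P j ω).real (A a) : J → Fin k → ℝ) :=
    measurable_pi_iff.2 fun j => measurable_pi_iff.2 fun a =>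
      (h.random j).measurable_real (hA.measurableSet a)
  let κ : Kernel (J → Measure E) (J → Fin k → ℝ) :=
    ⟨fun β => Measure.pi fun j => dirichletMeasure fun a => θ * (β j).real (A a),
      measurable_measure_pi (m := fun j (β : J → Measure E) =>
        dirichletMeasure fun a => θ * (β j).real (A a)) fun j => by
        refine measurable_dirichletMeasure.comp (measurable_pi_iff.2 fun a => ?_)
        exact (measurable_eval_measure (hA.measurableSet a) j).ennreal_toReal.const_mul θ⟩
  have hκ : ∀ β, κ β = Measure.pi fun j => dirichletMeasure fun a => θ * (β j).real (A a) :=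
    fun β => rfl
  have : IsMarkovKernel κ := ⟨fun β => by rw [hκ]; infer_instance⟩
  have : IsProbabilityMeasure (μ.map fun ω j => b j ω) :=
    Measure.isProbabilityMeasure_map hb.aemeasurable
  have key : μ.map (fun ω => ((fun j => b j ω), fun j a => (P j ω).real (A a))) =
      (μ.map fun ω j => b j ω) ⊗ₘ κ := by
    have : IsProbabilityMeasure
        (μ.map (fun ω => ((fun j => b j ω), fun j a => (P j ω).real (A a)))) :=
      Measure.isProbabilityMeasure_map (hb.prodMk hv).aemeasurable
    refine Measure.ext_prod fun {D t} hD ht => ?_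
    have hD' := hb hD
    rw [Measure.map_apply (hb.prodMk hv) (hD.prod ht), Measure.compProd_apply_prod hD ht]
    have e1 : ∀ t, MeasurableSet t → μ ((fun ω => ((fun j => b j ω), fun j a => (P j ω).real (A a)))
        ⁻¹' D ×ˢ t) = (μ.restrict ((fun ω j => b j ω) ⁻¹' D)).map
          (fun ω j a => (P j ω).real (A a)) t := fun t ht => by
      rw [Measure.map_apply hv ht, Measure.restrict_apply (hv ht), Set.inter_comm]
      rfl
    have e2 : ∀ t, MeasurableSet t → ∫⁻ β in D, κ β t ∂(μ.map fun ω j => b j ω) =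
        (((μ.map fun ω j => b j ω).restrict D).bind κ) t := fun t ht => by
      rw [Measure.bind_apply ht κ.aemeasurable]
    rw [e1 t ht, e2 t ht]
    congr 1
    have hpi : ∀ s ∈ Set.univ.pi '' Set.univ.pi fun _ : J => {s : Set (Fin k → ℝ) | MeasurableSet s},
        (μ.restrict ((fun ω j => b j ω) ⁻¹' D)).map (fun ω j a => (P j ω).real (A a)) s =
        (((μ.map fun ω j => b j ω).restrict D).bind κ) s := by
      rintro _ ⟨C, hC, rfl⟩
      have hC' : ∀ j, MeasurableSet (C j) := fun j => hC j (Set.mem_univ j)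
      have hCm : MeasurableSet (Set.univ.pi C) := MeasurableSet.univ_pi hC'
      rw [← e2 _ hCm, ← e1 _ hCm, setLIntegral_map hD (κ.measurable_coe hCm) hb]
      simp only [hκ, Measure.pi_pi]
      refine Eq.trans ?_ (h.law k A hA D hD C hC')
      congr 1
      ext ω
      simp
    refine ext_of_generate_finite _ generateFrom_pi.symm isPiSystem_pi hpi ?_
    refine hpi _ ⟨fun _ => Set.univ, fun _ _ => Set.mem_ofPred.2 MeasurableSet.univ, by simp⟩
  have h1 : ∫⁻ ω, φ (fun j => b j ω) * F (fun j a => (P j ω).real (A a)) ∂μ =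
      ∫⁻ p, φ p.1 * F p.2 ∂(μ.map (fun ω => ((fun j => b j ω), fun j a => (P j ω).real (A a)))) := by
    rw [lintegral_map (by fun_prop) (hb.prodMk hv)]
  rw [h1, key, Measure.lintegral_compProd (by fun_prop), lintegral_map _ hb]
  · refine lintegral_congr fun ω => ?_
    simp only
    rw [lintegral_const_mul _ hF, hκ]
  · exact Measurable.lintegral_kernel_prod_right' (f := fun p => φ p.1 * F p.2) (by fun_prop)

theorem measure_eq_sum_atoms {β : Type*} [Fintype β] [MeasurableSpace β]
    [DiscreteMeasurableSpace β] {k : ℕ} (e : Fin k ≃ β) (P : Measure E) [IsProbabilityMeasure P]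
    {g : E → β} (hg : Measurable g) (H : β → Prop) [DecidablePred H] :
    P {x | H (g x)} =
      ∑ i, (if H (e i) then 1 else 0) * ENNReal.ofReal (P.real (g ⁻¹' {e i})) := by
  classical
  have hr : ∀ s, ENNReal.ofReal (P.real s) = P s := fun s => ofReal_measureReal
  simp_rw [hr]
  rw [Equiv.sum_comp e fun y => (if H y then 1 else 0) * P (g ⁻¹' {y})]
  simp_rw [ite_mul, one_mul, zero_mul]
  rw [← Finset.sum_filter, sum_measure_preimage_singleton _ fun y _ => hg (measurableSet_singleton y)]
  congr 1
  ext x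
  simp

/-- The sets may overlap, so the Dirichlet law is applied to the atoms that they generate; each mass
is then a linear form in the masses of the atoms, and `multilinear_step` applies for each `ω`. The
weight `φ` is there to absorb the factor `b j₀ ω C` when the identity is iterated. -/
theorem IsCondDirichlet.moment_step [DecidableEq J] {ι : Type*} [DecidableEq ι] {θ : ℝ}
    (hθ : 0 < θ) {b P : J → Ω → Measure E} {μ : Measure Ω} [IsProbabilityMeasure μ]
    (h : IsCondDirichlet θ b μ P) {φ : (J → Measure E) → ℝ≥0∞} (hφ : Measurable φ)
    (l : ι → J) (S : Finset ι) {A : ι → Set E} (hA : ∀ u, MeasurableSet (A u))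
    (j₀ : J) {C : Set E} (hC : MeasurableSet C) :
    (ENNReal.ofReal θ + ((S.filter fun u => l u = j₀).card : ℝ≥0∞)) *
      ∫⁻ ω, φ (fun j => b j ω) * (P j₀ ω C * ∏ u ∈ S, P (l u) ω (A u)) ∂μ =
    ENNReal.ofReal θ * ∫⁻ ω, (φ (fun j => b j ω) * b j₀ ω C) * ∏ u ∈ S, P (l u) ω (A u) ∂μ +
    ∑ u' ∈ S.filter (fun u => l u = j₀), ∫⁻ ω, φ (fun j => b j ω) *
      ∏ u ∈ S, P (l u) ω (A u ∩ if u = u' then C else Set.univ) ∂μ := by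
  classical
  -- Records membership in `C` (at `none`) and in each `A u`; its fibres are the atoms.
  let g : E → Option S → Bool := fun x o => match o with
    | none => decide (x ∈ C)
    | some u => decide (x ∈ A u)
  have hg : Measurable g := by
    refine measurable_pi_iff.2 fun o => ?_
    rcases o with _ | u
    · exact measurable_to_bool (by simpa [g, Set.preimage] using hC)
    · exact measurable_to_bool (by simpa [g, Set.preimage] using hA u)
  let k := Fintype.card (Option S → Bool)
  let e : Fin k ≃ (Option S → Bool) := (Fintype.equivFin _).symm
  let B : Fin k → Set E := fun i => g ⁻¹' {e i}
  have hB : IsMeasurablePartition B := by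
    refine ⟨fun i => hg (measurableSet_singleton _), fun i i' hii => ?_, ?_⟩
    · refine Set.disjoint_left.2 fun x hx hx' => hii (e.injective ?_)
      simp only [B, Set.mem_preimage, Set.mem_singleton_iff] at hx hx'
      rw [← hx, ← hx']
    · refine Set.eq_univ_of_forall fun x => Set.mem_iUnion.2 ⟨e.symm (g x), ?_⟩
      simp [B]
  let f : ι → Fin k → ℝ≥0∞ := fun u i =>
    if hu : u ∈ S then (if e i (some ⟨u, hu⟩) = true then 1 else 0) else 0
  let gC : Fin k → ℝ≥0∞ := fun i => if e i none = true then 1 else 0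
  have rC : ∀ (p : Measure E) [IsProbabilityMeasure p],
      p C = ∑ i, gC i * ENNReal.ofReal (p.real (B i)) := fun p _ => by
    have := measure_eq_sum_atoms e p hg fun y => y none = true
    simpa [g, gC, B] using this
  have rA : ∀ (p : Measure E) [IsProbabilityMeasure p], ∀ u ∈ S,
      p (A u) = ∑ i, f u i * ENNReal.ofReal (p.real (B i)) := fun p _ u hu => by
    have := measure_eq_sum_atoms e p hg fun y => y (some ⟨u, hu⟩) = true
    simpa [g, f, B, hu] using this
  have rAC : ∀ (p : Measure E) [IsProbabilityMeasure p], ∀ u ∈ S, ∀ u' ∈ S,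
      p (A u ∩ if u = u' then C else Set.univ) = ∑ i, (f u i * if u = u' then gC i else 1) *
        ENNReal.ofReal (p.real (B i)) := fun p _ u hu u' hu' => by
    by_cases huu : u = u'
    · have := measure_eq_sum_atoms e p hg fun y => y (some ⟨u, hu⟩) = true ∧ y none = true
      simp only [g, decide_eq_true_eq] at this
      simp only [if_pos huu]
      rw [show A u ∩ C = {x | x ∈ A u ∧ x ∈ C} from rfl, this]
      refine Finset.sum_congr rfl fun i _ => ?_
      simp only [f, hu, gC, B, dif_pos]
      by_cases h1 : e i (some ⟨u, hu⟩) = true <;> by_cases h2 : e i none = true <;>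
        simp [h1, h2, g]
    · simp only [if_neg huu, Set.inter_univ, mul_one]
      exact rA p u hu
  have := fun j => (h.base j).isProbabilityMeasure
  have := fun j => (h.random j).isProbabilityMeasure
  have eL : ∫⁻ ω, φ (fun j => b j ω) * (P j₀ ω C * ∏ u ∈ S, P (l u) ω (A u)) ∂μ =
      ∫⁻ ω, φ (fun j => b j ω) * ∫⁻ x, (∑ i, gC i * ENNReal.ofReal (x j₀ i)) *
        ∏ u ∈ S, ∑ i, f u i * ENNReal.ofReal (x (l u) i)
        ∂(Measure.pi fun j => dirichletMeasure fun a => θ * (b j ω).real (B a)) ∂μ := by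
    rw [← h.lintegral_eq hB hφ (F := fun x => (∑ i, gC i * ENNReal.ofReal (x j₀ i)) *
        ∏ u ∈ S, ∑ i, f u i * ENNReal.ofReal (x (l u) i)) (by fun_prop)]
    refine lintegral_congr fun ω => ?_
    simp only
    rw [rC, Finset.prod_congr rfl fun u hu => rA (P (l u) ω) u hu]
  have eR : ∫⁻ ω, (φ (fun j => b j ω) * b j₀ ω C) * ∏ u ∈ S, P (l u) ω (A u) ∂μ =
      ∫⁻ ω, (φ (fun j => b j ω) * b j₀ ω C) *
        ∫⁻ x, ∏ u ∈ S, ∑ i, f u i * ENNReal.ofReal (x (l u) i)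
        ∂(Measure.pi fun j => dirichletMeasure fun a => θ * (b j ω).real (B a)) ∂μ := by
    rw [← h.lintegral_eq hB (φ := fun β => φ β * β j₀ C)
      (hφ.mul (measurable_eval_measure hC j₀))
      (F := fun x => ∏ u ∈ S, ∑ i, f u i * ENNReal.ofReal (x (l u) i)) (by fun_prop)]
    refine lintegral_congr fun ω => ?_
    simp only
    rw [Finset.prod_congr rfl fun u hu => rA (P (l u) ω) u hu]
  have eS : ∀ u' ∈ S, ∫⁻ ω, φ (fun j => b j ω) *
      ∏ u ∈ S, P (l u) ω (A u ∩ if u = u' then C else Set.univ) ∂μ =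
      ∫⁻ ω, φ (fun j => b j ω) *
        ∫⁻ x, ∏ u ∈ S, ∑ i, (f u i * if u = u' then gC i else 1) * ENNReal.ofReal (x (l u) i)
        ∂(Measure.pi fun j => dirichletMeasure fun a => θ * (b j ω).real (B a)) ∂μ := by
    intro u' hu'
    rw [← h.lintegral_eq hB hφ (F := fun x =>
      ∏ u ∈ S, ∑ i, (f u i * if u = u' then gC i else 1) * ENNReal.ofReal (x (l u) i))
      (by fun_prop)]
    refine lintegral_congr fun ω => ?_
    simp only
    rw [Finset.prod_congr rfl fun u hu => rAC (P (l u) ω) u hu u' hu']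
  have hbm : Measurable fun ω j => b j ω := measurable_pi_iff.2 fun j => (h.base j).measurable
  have hk : ∀ F : (J → Fin k → ℝ) → ℝ≥0∞, Measurable F → Measurable fun ω =>
      ∫⁻ x, F x ∂(Measure.pi fun j => dirichletMeasure fun a => θ * (b j ω).real (B a)) := by
    intro F hF
    refine (Measure.measurable_lintegral hF).comp (measurable_measure_pi (m := fun j (ω : Ω) =>
        dirichletMeasure fun a => θ * (b j ω).real (B a)) fun j => ?_)
    refine measurable_dirichletMeasure.comp (measurable_pi_iff.2 fun a => ?_)
    exact ((h.base j).measurable_real (hB.measurableSet a)).const_mul θ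
  have hφb : Measurable fun ω => φ fun j => b j ω := hφ.comp hbm
  have hbC := (h.base j₀).measurable_apply hC
  have m1 := hφb.mul (hk (fun x => (∑ i, gC i * ENNReal.ofReal (x j₀ i)) *
    ∏ u ∈ S, ∑ i, f u i * ENNReal.ofReal (x (l u) i)) (by fun_prop))
  have m2 := (hφb.mul hbC).mul
    (hk (fun x => ∏ u ∈ S, ∑ i, f u i * ENNReal.ofReal (x (l u) i)) (by fun_prop))
  have m3 := fun u' => hφb.mul (hk (fun x => ∏ u ∈ S, ∑ i,
    (f u i * if u = u' then gC i else 1) * ENNReal.ofReal (x (l u) i)) (by fun_prop))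
  simp only [Pi.mul_def] at m1 m2 m3
  rw [eL, eR, Finset.sum_congr rfl fun u' hu' => eS u' (Finset.mem_filter.1 hu').1,
    ← lintegral_const_mul _ m1, ← lintegral_const_mul _ m2,
    ← lintegral_finsetSum _ fun u' _ => m3 u', ← lintegral_add_left (m2.const_mul _)]
  refine lintegral_congr fun ω => ?_
  have hsum : ∀ j, ∑ i, θ * (b j ω).real (B i) = θ := fun j => by
    rw [← Finset.mul_sum]
    have h1 : ∑ i, (b j ω).real (B i) = 1 := by
      have := measure_eq_sum_atoms e (b j ω) hg fun _ => True
      simp only [Set.ofPred_true, measure_univ, if_true, one_mul] at this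
      rw [← ENNReal.ofReal_sum_of_nonneg (fun i _ => measureReal_nonneg)] at this
      have := this.symm
      rwa [ENNReal.ofReal_eq_one] at this
    rw [h1, mul_one]
  have hm := multilinear_step hθ (a := fun j i => θ * (b j ω).real (B i))
    (fun j i => mul_nonneg hθ.le measureReal_nonneg) hsum l S f j₀ gC
  have hbase : ∑ i, gC i * ENNReal.ofReal (θ * (b j₀ ω).real (B i)) =
      ENNReal.ofReal θ * b j₀ ω C := by
    rw [rC, Finset.mul_sum]
    refine Finset.sum_congr rfl fun i _ => ?_
    rw [ENNReal.ofReal_mul hθ.le]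
    ring
  rw [hbase] at hm
  rw [mul_left_comm, hm, mul_add, Finset.mul_sum]
  ring

end Moments

/-! ### Labels in order of appearance -/

section Labels

variable {ι α β : Type*} [LinearOrder ι]

theorem exists_first_occurrence (s : Finset ι) (x : ι → α) {i : ι} (hi : i ∈ s) :
    ∃ a ∈ s, x a = x i ∧ (∀ k ∈ s, k < a → x k ≠ x a) ∧ ∀ k ∈ s, x k = x i → a ≤ k := by
  classical
  have hne : (s.filter fun k => x k = x i).Nonempty := ⟨i, by simp [hi]⟩
  have hm := Finset.mem_filter.1 (Finset.min'_mem _ hne)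
  have hle : ∀ k ∈ s, x k = x i → (s.filter fun k => x k = x i).min' hne ≤ k :=
    fun k hk hx => Finset.min'_le _ _ (Finset.mem_filter.2 ⟨hk, hx⟩)
  refine ⟨_, hm.1, hm.2, fun k hk hlt hx => ?_, hle⟩
  exact absurd (hle k hk (hx.trans hm.2)) (not_le.2 hlt)

theorem label_lt {s : Finset ι} {x : ι → α} {a i : ι} (ha : a ∈ s)
    (hfirst : ∀ k ∈ s, k < a → x k ≠ x a) (h : ∀ k ∈ s, x k = x i → a < k) :
    label s x a < label s x i := by
  unfold label
  refine Nat.add_lt_add_left (Finset.card_lt_card ⟨fun k hk => ?_, fun hsub => ?_⟩) 1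
  · simp only [Finset.mem_filter] at hk ⊢
    exact ⟨hk.1, hk.2.1, fun i' hi' hx => (hk.2.2 a ha rfl).trans (h i' hi' hx)⟩
  · have := @hsub a (by simp only [Finset.mem_filter]; exact ⟨ha, hfirst, h⟩)
    simp only [Finset.mem_filter] at this
    exact lt_irrefl _ (this.2.2 a ha rfl)

theorem label_congr_value {s : Finset ι} {x : ι → α} {i i' : ι} (h : x i = x i') :
    label s x i = label s x i' := by
  unfold label
  rw [h]

/-- Distinct values on `s` have distinct first places, and the earlier place has the smaller label.
Only `i` has to lie in `s`: a value absent from `s` has a label above all those on `s`. -/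
theorem label_eq_label_iff {s : Finset ι} {x : ι → α} {i i' : ι} (hi : i ∈ s) :
    label s x i' = label s x i ↔ x i' = x i := by
  refine ⟨fun h => ?_, label_congr_value⟩
  by_contra hne
  obtain ⟨a, ha, hai, hfa, hmin⟩ := exists_first_occurrence s x hi
  rw [← label_congr_value hai] at h
  by_cases hex : ∃ k ∈ s, x k = x i'
  · obtain ⟨k, hk, hki⟩ := hex
    obtain ⟨b, hb, hbi, hfb, hminb⟩ := exists_first_occurrence s x hk
    rw [hki] at hbi
    rw [← label_congr_value hbi] at h
    have hab : a ≠ b := fun hab => hne (by rw [← hai, ← hbi, hab])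
    rcases lt_or_gt_of_ne hab with hlt | hlt
    · refine absurd h (label_lt ha hfa fun k' hk' hx => ?_).ne'
      exact hlt.trans_le (hminb k' hk' (by rw [hx, hbi, hki]))
    · refine absurd h (label_lt hb hfb fun k' hk' hx => ?_).ne
      exact hlt.trans_le (hmin k' hk' (by rw [hx, hai]))
  · push Not at hex
    exact absurd h (label_lt ha hfa fun k' hk' hx => absurd hx (hex k' hk')).ne'

/-- The definition of `label` uses nothing but equalities among values at `s` and at `i`. All later
invariance and measurability statements about labels come from this. -/
theorem label_congr {s : Finset ι} {x : ι → α} {y : ι → β} {i : ι}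
    (h : ∀ a ∈ insert i s, ∀ b ∈ insert i s, x a = x b ↔ y a = y b) :
    label s x i = label s y i := by
  unfold label
  congr 2
  ext k
  simp only [Finset.mem_filter]
  refine and_congr_right fun hk => and_congr ?_ ?_
  · refine forall_congr' fun k' => forall_congr' fun hk' => imp_congr_right fun _ => not_congr ?_
    exact h _ (Finset.mem_insert_of_mem hk') _ (Finset.mem_insert_of_mem hk)
  · refine forall_congr' fun k' => forall_congr' fun hk' => imp_congr ?_ Iff.rfl
    exact h _ (Finset.mem_insert_of_mem hk') _ (Finset.mem_insert_self _ _)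

open Classical in
theorem card_first_occurrences (s : Finset ι) (x : ι → α) :
    (s.filter fun k => ∀ k' ∈ s, k' < k → x k' ≠ x k).card = (s.image x).card := by
  have himg : (s.filter fun k => ∀ k' ∈ s, k' < k → x k' ≠ x k).image x = s.image x := by
    ext y
    simp only [Finset.mem_image, Finset.mem_filter]
    constructor
    · rintro ⟨k, hk, rfl⟩
      exact ⟨k, hk.1, rfl⟩
    · rintro ⟨k, hk, rfl⟩
      obtain ⟨a, ha, hai, hfa, -⟩ := exists_first_occurrence s x hk
      exact ⟨a, ⟨ha, hfa⟩, hai⟩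
  rw [← himg, Finset.card_image_of_injOn]
  intro a ha b hb hab
  simp only [Finset.coe_filter, Set.mem_ofPred_eq] at ha hb
  by_contra hne
  rcases lt_or_gt_of_ne hne with hlt | hlt
  · exact hb.2 a ha.1 hlt hab
  · exact ha.2 b hb.1 hlt hab.symm

open Classical in
theorem label_le {s : Finset ι} {x : ι → α} {i : ι} (hi : i ∈ s) :
    label s x i ≤ (s.image x).card := by
  obtain ⟨a, ha, hai, hfa, hmin⟩ := exists_first_occurrence s x hi
  rw [← card_first_occurrences, ← label_congr_value hai, label, add_comm, Nat.add_one_le_iff]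
  refine Finset.card_lt_card ⟨fun k hk => ?_, fun hsub => ?_⟩
  · simp only [Finset.mem_filter] at hk ⊢
    exact ⟨hk.1, hk.2.1⟩
  · have := @hsub a (by simp only [Finset.mem_filter]; exact ⟨ha, hfa⟩)
    simp only [Finset.mem_filter] at this
    exact lt_irrefl _ (this.2.2 a ha rfl)

open Classical in
theorem label_of_new {s : Finset ι} {x : ι → α} {i : ι} (hi : ∀ k ∈ s, x k ≠ x i) :
    label s x i = (s.image x).card + 1 := by
  rw [← card_first_occurrences, label, add_comm]
  congr 2
  ext k
  simp only [Finset.mem_filter]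
  exact and_congr_right fun hk => and_iff_left fun i' hi' hx => absurd hx (hi i' hi')

theorem one_le_label (s : Finset ι) (x : ι → α) (i : ι) : 1 ≤ label s x i :=
  Nat.le_add_right 1 _

/-- Both images are in bijection with the image of the pair `(x, y)`. -/
theorem card_image_eq_of_ker {κ : Type*} [DecidableEq α] [DecidableEq β] {s : Finset κ} {x : κ → α}
    {y : κ → β} (h : ∀ a ∈ s, ∀ b ∈ s, x a = x b ↔ y a = y b) :
    (s.image x).card = (s.image y).card := by
  have h1 : ((s.image fun a => (x a, y a)).image Prod.fst).card =
      (s.image fun a => (x a, y a)).card := by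
    refine Finset.card_image_of_injOn fun p hp q hq hpq => ?_
    simp only [Finset.coe_image, Set.mem_image, Finset.mem_coe] at hp hq
    obtain ⟨a, ha, rfl⟩ := hp
    obtain ⟨b, hb, rfl⟩ := hq
    exact Prod.ext hpq ((h a ha b hb).1 hpq)
  have h2 : ((s.image fun a => (x a, y a)).image Prod.snd).card =
      (s.image fun a => (x a, y a)).card := by
    refine Finset.card_image_of_injOn fun p hp q hq hpq => ?_
    simp only [Finset.coe_image, Set.mem_image, Finset.mem_coe] at hp hq
    obtain ⟨a, ha, rfl⟩ := hp
    obtain ⟨b, hb, rfl⟩ := hq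
    exact Prod.ext ((h a ha b hb).2 hpq) hpq
  rw [Finset.image_image] at h1 h2
  exact h1.trans h2.symm

theorem image_label (s : Finset ι) (x : ι → α) [DecidableEq α] :
    s.image (label s x) = Finset.Icc 1 (s.image x).card := by
  classical
  refine Finset.eq_of_subset_of_card_le (fun h hh => ?_) ?_
  · obtain ⟨i, hi, rfl⟩ := Finset.mem_image.1 hh
    refine Finset.mem_Icc.2 ⟨one_le_label _ _ _, ?_⟩
    refine (label_le hi).trans (le_of_eq ?_)
    congr!
  · rw [Nat.card_Icc, Nat.add_sub_cancel]
    exact (card_image_eq_of_ker fun a _ b hb => (label_eq_label_iff hb).symm).le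

end Labels

/-! ### Relabelling after the removal of a node -/

section Removal

variable {d : ℕ} {V : Fin d → ℕ} {α : Type*}

theorem mem_layerNodes {u : Node V} {j : Fin d} : u ∈ layerNodes V j ↔ layer u = j := by
  simp [layerNodes]

/-- Labels have the same ties as the values that they label, so relabelling them amounts to
labelling the original values directly. -/
theorem removeAllocation_allocation (v : Node V) (x : Node V → α) :
    removeAllocation v (allocation x) = fun u : Rest v => label (Finset.univ.erase v) x u.1 := by
  ext u
  exact label_congr fun _ _ b _ => label_eq_label_iff (Finset.mem_univ b)

theorem assigned_allocation (v : Node V) (x : Node V → α) :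
    assigned v (allocation x) = label (Finset.univ.erase v) x v :=
  label_congr fun _ _ b _ => label_eq_label_iff (Finset.mem_univ b)

theorem subgroups_eq_iff {t : Node V → α} {a b : Node V} (h : layer a = layer b) :
    subgroups t a = subgroups t b ↔ t a = t b := by
  unfold subgroups
  rw [h]
  exact label_eq_label_iff (mem_layerNodes.2 rfl)

theorem removeSubgroups_subgroups (v : Node V) (t : Node V → α) :
    removeSubgroups v (subgroups t) =
      fun u : Rest v => label ((layerNodes V (layer u.1)).erase v) t u.1 := by
  ext u
  refine label_congr fun a ha b hb => subgroups_eq_iff ?_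
  have : ∀ a ∈ insert u.1 ((layerNodes V (layer u.1)).erase v), layer a = layer u.1 := by
    intro a ha
    rcases Finset.mem_insert.1 ha with rfl | ha
    · rfl
    · exact mem_layerNodes.1 (Finset.mem_of_mem_erase ha)
  rw [this a ha, this b hb]

end Removal

/-- There are finitely many patterns of ties and each is a measurable event, because equality of
coordinates is measurable in a standard Borel space. No structure on `β` is needed. -/
theorem measurable_of_ker {ι E β : Type*} [Finite ι] [MeasurableSpace E] [StandardBorelSpace E]
    [MeasurableSpace β] {f : (ι → E) → β}
    (hf : ∀ x y : ι → E, (∀ a b, x a = x b ↔ y a = y b) → f x = f y) : Measurable f := by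
  let g : (ι → E) → ι → ι → Prop := fun x a b => x a = x b
  have hg : Measurable g := by
    refine measurable_pi_iff.2 fun a => measurable_pi_iff.2 fun b => ?_
    exact measurableSet_setOfPred.1 (measurableSet_eq_fun (measurable_pi_apply a)
      (measurable_pi_apply b))
  intro s _
  have : f ⁻¹' s = g ⁻¹' (g '' (f ⁻¹' s)) := by
    refine (Set.subset_preimage_image g _).antisymm ?_
    rintro x ⟨y, hy, hxy⟩
    rw [Set.mem_preimage, ← hf y x fun a b => ?_]
    · exact hy
    · exact iff_of_eq (congrFun (congrFun hxy a) b)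
  rw [this]
  exact hg (Set.toFinite _).measurableSet

/-! ### Pólya urns and the law of their ties -/

section Urn

variable {ι J E Ω : Type*} [Fintype ι] [DecidableEq ι] [Fintype J] [DecidableEq J]
  [MeasurableSpace E] [MeasurableSpace Ω]

/-- `ν` is the law of variables that are conditionally independent with (random) laws `R i`. -/
def IsSampleLaw (μ : Measure Ω) (R : ι → Ω → Measure E) (ν : Measure (ι → E)) : Prop :=
  ∀ A : ι → Set E, (∀ i, MeasurableSet (A i)) →
    ν (Set.univ.pi A) = ∫⁻ ω, ∏ i, R i ω (A i) ∂μ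

/-- The Pólya urn identity, for variables `x i` that are sampled in layers `l i`. -/
def IsUrn (θ : ℝ) (l : ι → J) (G : J → Measure E) (ν : Measure (ι → E)) : Prop :=
  ∀ (S : Finset ι) (v : ι), v ∉ S → ∀ F : (ι → E) → ℝ≥0∞, Measurable F →
    (∀ x y, (∀ u ∈ insert v S, x u = y u) → F x = F y) →
    (ENNReal.ofReal θ + ((S.filter fun u => l u = l v).card : ℝ≥0∞)) * ∫⁻ x, F x ∂ν =
      ENNReal.ofReal θ * ∫⁻ x, ∫⁻ y, F (Function.update x v y) ∂(G (l v)) ∂ν +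
      ∑ u' ∈ S.filter (fun u => l u = l v), ∫⁻ x, F (Function.update x v (x u')) ∂ν

omit [DecidableEq ι] in
theorem IsSampleLaw.isProbabilityMeasure {μ : Measure Ω} [IsProbabilityMeasure μ]
    {R : ι → Ω → Measure E} (hR : ∀ i ω, IsProbabilityMeasure (R i ω)) {ν : Measure (ι → E)}
    (h : IsSampleLaw μ R ν) : IsProbabilityMeasure ν :=
  ⟨by simpa using h (fun _ => Set.univ) fun _ => MeasurableSet.univ⟩

omit [DecidableEq ι] in
theorem measure_ext_of_pi {ν ν' : Measure (ι → E)} [IsFiniteMeasure ν]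
    (h : ∀ A : ι → Set E, (∀ i, MeasurableSet (A i)) →
      ν (Set.univ.pi A) = ν' (Set.univ.pi A)) : ν = ν' := by
  refine ext_of_generate_finite _ generateFrom_pi.symm isPiSystem_pi ?_ ?_
  · rintro _ ⟨A, hA, rfl⟩
    exact h A fun i => hA i (Set.mem_univ i)
  · simpa using h (fun _ => Set.univ) fun _ => MeasurableSet.univ

/-- For indicators of rectangles this is `moment_step` with `φ = 1`. Both sides are integrals of `F`
against measures, so agreement on the π-system of rectangles gives it for every `F`. -/
theorem IsSampleLaw.isUrn {θ : ℝ} (hθ : 0 < θ) {μ : Measure Ω} [IsProbabilityMeasure μ]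
    {G : J → Measure E} [∀ j, IsProbabilityMeasure (G j)] {P : J → Ω → Measure E}
    (hP : IsCondDirichlet θ (fun j _ => G j) μ P) {l : ι → J} {ν : Measure (ι → E)}
    (hν : IsSampleLaw μ (fun i => P (l i)) ν) : IsUrn θ l G ν := by
  intro S v hv F hF hdep
  have hPp := fun j => (hP.random j).isProbabilityMeasure
  have := hν.isProbabilityMeasure fun i => hPp (l i)
  obtain ⟨e₀⟩ : Nonempty E := nonempty_of_isProbabilityMeasure (G (l v))
  -- Coordinates outside `insert v S` are overwritten by `e₀`: `F` does not see them, and the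
  -- identity of measures is only true once they are forgotten.
  let ρ : (ι → E) → ι → E := fun x u => if u ∈ insert v S then x u else e₀
  have hρ : Measurable ρ := measurable_pi_iff.2 fun u => by
    by_cases hu : u ∈ insert v S
    · simpa only [ρ, if_pos hu] using measurable_pi_apply u
    · simp only [ρ, if_neg hu, measurable_const]
  have hFρ : ∀ x, F (ρ x) = F x := fun x => hdep _ _ fun u hu => by simp only [ρ, if_pos hu]
  have hup : Measurable fun p : (ι → E) × E => Function.update p.1 v p.2 := by fun_prop
  have hρup : Measurable fun p : (ι → E) × E => ρ (Function.update p.1 v p.2) := hρ.comp hup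
  have hρuu : ∀ u, Measurable fun x : ι → E => ρ (Function.update x v (x u)) := fun u =>
    hρ.comp (by fun_prop)
  set c : ℝ≥0∞ := ENNReal.ofReal θ + ((S.filter fun u => l u = l v).card : ℝ≥0∞) with hc
  have hctop : c ≠ ∞ := by simp [hc]
  have key : c • ν.map ρ =
      ENNReal.ofReal θ • (ν.prod (G (l v))).map (fun p => ρ (Function.update p.1 v p.2)) +
        ∑ u' ∈ S.filter (fun u => l u = l v), ν.map fun x => ρ (Function.update x v (x u')) := by
    have := Measure.isProbabilityMeasure_map (μ := ν) hρ.aemeasurable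
    have : IsFiniteMeasure (c • ν.map ρ) := Measure.smul_finite _ hctop
    refine measure_ext_of_pi fun A hA => ?_
    have hAm : MeasurableSet (Set.univ.pi A) := MeasurableSet.univ_pi hA
    simp only [Measure.smul_apply, Measure.add_apply, Measure.finsetSum_apply, smul_eq_mul]
    rw [Measure.map_apply hρ hAm, Measure.map_apply hρup hAm,
      Finset.sum_congr rfl fun u' _ => Measure.map_apply (hρuu u') hAm]
    -- If the rectangle admits the default values it constrains only `insert v S`; otherwise every
    -- term vanishes.
    by_cases he : ∀ u, u ∉ insert v S → e₀ ∈ A u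
    · have mem : ∀ x, ρ x ∈ Set.univ.pi A ↔ ∀ u ∈ insert v S, x u ∈ A u := fun x => by
        simp only [Set.mem_pi, Set.mem_univ, true_imp_iff]
        refine ⟨fun h u hu => by simpa only [ρ, if_pos hu] using h u, fun h u => ?_⟩
        by_cases hu : u ∈ insert v S
        · simpa only [ρ, if_pos hu] using h u hu
        · simpa only [ρ, if_neg hu] using he u hu
      have rect : ∀ (S' : Finset ι) (B : ι → Set E), (∀ u, MeasurableSet (B u)) →
          ν {x | ∀ u ∈ S', x u ∈ B u} = ∫⁻ ω, ∏ u ∈ S', P (l u) ω (B u) ∂μ := by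
        intro S' B hB
        have e : {x : ι → E | ∀ u ∈ S', x u ∈ B u} =
            Set.univ.pi fun u => if u ∈ S' then B u else Set.univ := by
          ext x
          simp only [Set.mem_ofPred_eq, Set.mem_pi, Set.mem_univ, true_imp_iff]
          refine forall_congr' fun u => ?_
          split_ifs with hu <;> simp [hu]
        rw [e, hν _ fun u => by split_ifs; exacts [hB u, MeasurableSet.univ]]
        refine lintegral_congr fun ω => ?_
        rw [← Finset.prod_subset (Finset.subset_univ S') fun u _ hu => by
          rw [if_neg hu, measure_univ]]
        exact Finset.prod_congr rfl fun u hu => by rw [if_pos hu]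
      have r1 : ρ ⁻¹' Set.univ.pi A = {x | ∀ u ∈ insert v S, x u ∈ A u} := Set.ext mem
      have r2 : (fun p : (ι → E) × E => ρ (Function.update p.1 v p.2)) ⁻¹' Set.univ.pi A =
          {x | ∀ u ∈ S, x u ∈ A u} ×ˢ A v := by
        ext ⟨x, y⟩
        rw [Set.mem_preimage, mem]
        simp only [Finset.forall_mem_insert, Function.update_self, Set.mem_prod,
          Set.mem_ofPred_eq]
        rw [and_comm]
        refine and_congr (forall₂_congr fun u hu => ?_) Iff.rfl
        rw [Function.update_of_ne (ne_of_mem_of_not_mem hu hv)]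
      have r3 : ∀ u' ∈ S.filter (fun u => l u = l v),
          (fun x : ι → E => ρ (Function.update x v (x u'))) ⁻¹' Set.univ.pi A =
          {x | ∀ u ∈ S, x u ∈ A u ∩ if u = u' then A v else Set.univ} := by
        intro u' hu'
        have hu'S := (Finset.mem_filter.1 hu').1
        ext x
        rw [Set.mem_preimage, mem]
        simp only [Finset.forall_mem_insert, Function.update_self, Set.mem_ofPred_eq,
          Set.mem_inter_iff]
        constructor
        · rintro ⟨h1, h2⟩ u hu
          refine ⟨by simpa [Function.update_of_ne (ne_of_mem_of_not_mem hu hv)] using h2 u hu, ?_⟩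
          split_ifs with huu'
          · rwa [huu']
          · trivial
        · intro h
          refine ⟨by simpa using (h u' hu'S).2, fun u hu => ?_⟩
          rw [Function.update_of_ne (ne_of_mem_of_not_mem hu hv)]
          exact (h u hu).1
      have hstep := hP.moment_step hθ (φ := fun _ => 1) measurable_const l S hA (l v) (hA v)
      simp only [one_mul] at hstep
      rw [r1, rect _ A hA, r2, Measure.prod_prod, rect _ A hA, mul_comm _ (G (l v) (A v)),
        ← lintegral_const_mul (G (l v) (A v))]
      · rw [Finset.sum_congr rfl fun u' hu' => by rw [r3 u' hu', rect _ _ fun u => (hA u).inter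
          (by split_ifs; exacts [hA v, MeasurableSet.univ])]]
        simp only [Finset.prod_insert hv]
        exact hstep
      · exact Finset.measurable_prod _ fun u _ => (hP.random (l u)).measurable_apply (hA u)
    · push Not at he
      obtain ⟨u, hu, hAu⟩ := he
      have hno : ∀ x, ρ x ∉ Set.univ.pi A := fun x hx => hAu (by
        simpa only [ρ, if_neg hu] using hx u (Set.mem_univ u))
      have z1 : ρ ⁻¹' Set.univ.pi A = ∅ := Set.eq_empty_of_forall_notMem fun x => hno x
      have z2 : (fun p : (ι → E) × E => ρ (Function.update p.1 v p.2)) ⁻¹' Set.univ.pi A = ∅ :=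
        Set.eq_empty_of_forall_notMem fun x => hno _
      have z3 : ∀ u', (fun x : ι → E => ρ (Function.update x v (x u'))) ⁻¹' Set.univ.pi A = ∅ :=
        fun u' => Set.eq_empty_of_forall_notMem fun x => hno _
      change c * _ = ENNReal.ofReal θ * (ν.prod (G (l v))) ((fun p : (ι → E) × E =>
        ρ (Function.update p.1 v p.2)) ⁻¹' Set.univ.pi A) + ∑ u' ∈ S.filter (fun u => l u = l v),
        ν ((fun x : ι → E => ρ (Function.update x v (x u'))) ⁻¹' Set.univ.pi A)
      rw [z1, z2, Finset.sum_congr rfl fun u' _ => by rw [z3]]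
      simp
  have hL := congrArg (fun m : Measure (ι → E) => ∫⁻ x, F x ∂m) key
  simp only [lintegral_smul_measure, lintegral_add_measure, smul_eq_mul,
    lintegral_finsetSum_measure] at hL
  rw [lintegral_map hF hρ, lintegral_map hF hρup,
    Finset.sum_congr rfl fun u' _ => lintegral_map hF (hρuu u')] at hL
  simp only [hFρ] at hL
  rw [hL, lintegral_prod (fun p : (ι → E) × E => F (Function.update p.1 v p.2))
    (hF.comp hup).aemeasurable]

-- A fresh draw from a diffuse base almost surely avoids the finitely many values present, so the
-- base measure leaves the formula.
omit [Fintype J] in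
theorem IsUrn.lintegral_eq {θ : ℝ} {l : ι → J} {G : J → Measure E}
    [∀ j, IsProbabilityMeasure (G j)] [∀ j, NullSingletonClass (G j)] {ν : Measure (ι → E)}
    (h : IsUrn θ l G ν) {S : Finset ι} {v : ι} (hv : v ∉ S) {F F₀ : (ι → E) → ℝ≥0∞}
    (hF : Measurable F) (hdep : ∀ x y, (∀ u ∈ insert v S, x u = y u) → F x = F y)
    (hnew : ∀ x y, (∀ u, x u ≠ y) → F (Function.update x v y) = F₀ x) :
    (ENNReal.ofReal θ + ((S.filter fun u => l u = l v).card : ℝ≥0∞)) * ∫⁻ x, F x ∂ν =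
      ENNReal.ofReal θ * ∫⁻ x, F₀ x ∂ν +
      ∑ u' ∈ S.filter (fun u => l u = l v), ∫⁻ x, F (Function.update x v (x u')) ∂ν := by
  rw [h S v hv F hF hdep]
  congr 2
  refine lintegral_congr fun x => ?_
  have : ∀ᵐ y ∂(G (l v)), F (Function.update x v y) = F₀ x := by
    have h0 : (G (l v)) (Set.range x) = 0 := (Set.finite_range x).measure_zero _
    filter_upwards [measure_eq_zero_iff_ae_notMem.1 h0] with y hy
    exact hnew x y fun u hu => hy ⟨u, hu⟩
  rw [lintegral_congr_ae this]
  simp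

/-- The restriction to `S` of the pattern of ties of `x` is the one of `f`. -/
def tiePattern {α : Type*} (S : Finset ι) (f : ι → α) : Set (ι → E) :=
  {x | ∀ a ∈ S, ∀ b ∈ S, x a = x b ↔ f a = f b}

omit [DecidableEq ι] in
theorem measurableSet_tiePattern [StandardBorelSpace E] {α : Type*} (S : Finset ι) (f : ι → α) :
    MeasurableSet (tiePattern (E := E) S f) := by
  have : Measurable fun x : ι → E => ∀ a ∈ S, ∀ b ∈ S, x a = x b ↔ f a = f b :=
    measurable_of_ker fun x y hxy => by simp only [hxy]
  exact measurableSet_setOfPred.2 this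

omit [Fintype ι] [MeasurableSpace E] in
theorem update_mem_tiePattern {α : Type*} {S : Finset ι} {f : ι → α} {v u : ι} (hv : v ∉ S)
    (hu : u ∈ S) (x : ι → E) :
    Function.update x v (x u) ∈ tiePattern (insert v S) f ↔ x ∈ tiePattern S f ∧ f u = f v := by
  have hne : ∀ a ∈ S, a ≠ v := fun a ha => ne_of_mem_of_not_mem ha hv
  simp only [tiePattern, Set.mem_ofPred_eq, Finset.forall_mem_insert, Function.update_self]
  constructor
  · rintro ⟨⟨-, h1⟩, h2⟩
    refine ⟨fun a ha b hb => ?_, ?_⟩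
    · have := (h2 a ha).2 b hb
      rwa [Function.update_of_ne (hne a ha), Function.update_of_ne (hne b hb)] at this
    · have := (h1 u hu).1
      rw [Function.update_of_ne (hne u hu)] at this
      exact (this rfl).symm
  · rintro ⟨h, huv⟩
    refine ⟨⟨by simp, fun b hb => ?_⟩, fun a ha => ⟨?_, fun b hb => ?_⟩⟩
    · rw [Function.update_of_ne (hne b hb), h u hu b hb, huv]
    · rw [Function.update_of_ne (hne a ha), h a ha u hu, huv]
    · rw [Function.update_of_ne (hne a ha), Function.update_of_ne (hne b hb), h a ha b hb]

omit [Fintype ι] [MeasurableSpace E] in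
theorem update_new_mem_tiePattern {α : Type*} {S : Finset ι} {f : ι → α} {v : ι} (hv : v ∉ S)
    {x : ι → E} {y : E} (hy : ∀ u, x u ≠ y) :
    Function.update x v y ∈ tiePattern (insert v S) f ↔
      x ∈ tiePattern S f ∧ ∀ u ∈ S, f u ≠ f v := by
  have hne : ∀ a ∈ S, a ≠ v := fun a ha => ne_of_mem_of_not_mem ha hv
  simp only [tiePattern, Set.mem_ofPred_eq, Finset.forall_mem_insert, Function.update_self]
  constructor
  · rintro ⟨⟨-, h1⟩, h2⟩
    refine ⟨fun a ha b hb => ?_, fun u hu huv => ?_⟩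
    · have := (h2 a ha).2 b hb
      rwa [Function.update_of_ne (hne a ha), Function.update_of_ne (hne b hb)] at this
    · have := (h2 u hu).1
      rw [Function.update_of_ne (hne u hu)] at this
      exact hy u (this.2 huv)
  · rintro ⟨h, hnew⟩
    refine ⟨⟨by simp, fun b hb => ?_⟩, fun a ha => ⟨?_, fun b hb => ?_⟩⟩
    · rw [Function.update_of_ne (hne b hb)]
      exact iff_of_false (hy b).symm (hnew b hb).symm
    · rw [Function.update_of_ne (hne a ha)]
      exact iff_of_false (hy a) (hnew a ha)
    · rw [Function.update_of_ne (hne a ha), Function.update_of_ne (hne b hb), h a ha b hb]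

open Classical in
theorem IsUrn.measure_tiePattern_insert [StandardBorelSpace E] {θ : ℝ} {l : ι → Unit}
    {G : Unit → Measure E} [∀ j, IsProbabilityMeasure (G j)] [∀ j, NullSingletonClass (G j)]
    {ν : Measure (ι → E)} (h : IsUrn θ l G ν) {α : Type*} {S : Finset ι} {v : ι} (hv : v ∉ S)
    (f : ι → α) :
    (ENNReal.ofReal θ + (S.card : ℝ≥0∞)) * ν (tiePattern (insert v S) f) =
      ENNReal.ofReal θ * (if ∀ u ∈ S, f u ≠ f v then ν (tiePattern S f) else 0) +
        ∑ u ∈ S, if f u = f v then ν (tiePattern S f) else 0 := by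
  have hm := fun S : Finset ι => measurableSet_tiePattern (E := E) S f
  have := h.lintegral_eq hv (F := (tiePattern (insert v S) f).indicator 1)
    (F₀ := fun x => if ∀ u ∈ S, f u ≠ f v then (tiePattern S f).indicator 1 x else 0)
    (measurable_one.indicator (hm _)) (fun x y hxy => ?_) (fun x y hxy => ?_)
  · rw [lintegral_indicator_one (hm _)] at this
    simp only [Finset.filter_true] at this
    rw [this]
    congr 1
    · split_ifs
      · rw [lintegral_indicator_one (hm _)]
      · simp
    · refine Finset.sum_congr rfl fun u hu => ?_
      simp only [Set.indicator_apply, update_mem_tiePattern hv hu]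
      by_cases huv : f u = f v
      · simp only [huv, and_true, if_true]
        rw [← lintegral_indicator_one (hm S)]
        rfl
      · simp [huv]
  · have : x ∈ tiePattern (insert v S) f ↔ y ∈ tiePattern (insert v S) f := by
      refine forall₂_congr fun a ha => forall₂_congr fun b hb => ?_
      rw [hxy a ha, hxy b hb]
    simp only [Set.indicator_apply, this, Pi.one_apply]
  · simp only [Set.indicator_apply, update_new_mem_tiePattern hv hxy]
    split_ifs <;> simp_all

/-- The recursion `measure_tiePattern_insert` does not involve the base measure, and its coefficient
`θ + |S|` can be cancelled; induct on `S`. -/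
theorem IsUrn.measure_tiePattern_eq [StandardBorelSpace E] {θ : ℝ} (hθ : 0 < θ) {l : ι → Unit}
    {G G' : Unit → Measure E} [∀ j, IsProbabilityMeasure (G j)] [∀ j, NullSingletonClass (G j)]
    [∀ j, IsProbabilityMeasure (G' j)] [∀ j, NullSingletonClass (G' j)]
    {ν ν' : Measure (ι → E)} [IsProbabilityMeasure ν] [IsProbabilityMeasure ν']
    (h : IsUrn θ l G ν) (h' : IsUrn θ l G' ν') {α : Type*} (f : ι → α) (S : Finset ι) :
    ν (tiePattern S f) = ν' (tiePattern S f) := by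
  classical
  induction S using Finset.induction_on with
  | empty => simp [tiePattern]
  | insert v S hv ih =>
    have h1 := h.measure_tiePattern_insert hv f
    have h2 := h'.measure_tiePattern_insert hv f
    rw [ih, ← h2, ENNReal.mul_right_inj] at h1
    · exact h1
    · simp [hθ]
    · simp

theorem IsUrn.measure_eq_of_ker [StandardBorelSpace E] {θ : ℝ} (hθ : 0 < θ) {l : ι → Unit}
    {G G' : Unit → Measure E} [∀ j, IsProbabilityMeasure (G j)] [∀ j, NullSingletonClass (G j)]
    [∀ j, IsProbabilityMeasure (G' j)] [∀ j, NullSingletonClass (G' j)]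
    {ν ν' : Measure (ι → E)} [IsProbabilityMeasure ν] [IsProbabilityMeasure ν']
    (h : IsUrn θ l G ν) (h' : IsUrn θ l G' ν') {W : Set (ι → E)}
    (hW : ∀ x y : ι → E, (∀ a b, x a = x b ↔ y a = y b) → x ∈ W → y ∈ W) : ν W = ν' W := by
  let g : (ι → E) → ι → ι → Prop := fun x a b => x a = x b
  have hg : Measurable g := measurable_of_ker fun x y hxy => by
    funext a b
    exact propext (hxy a b)
  have hmap : ν.map g = ν'.map g := by
    refine Measure.ext_iff_singleton.2 fun p => ?_
    rw [Measure.map_apply hg (measurableSet_singleton p),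
      Measure.map_apply hg (measurableSet_singleton p)]
    by_cases hp : ∃ x₀, g x₀ = p
    · obtain ⟨x₀, rfl⟩ := hp
      have : g ⁻¹' {g x₀} = tiePattern Finset.univ x₀ := by
        ext x
        simp only [Set.mem_preimage, Set.mem_singleton_iff, tiePattern, Set.mem_ofPred_eq,
          Finset.mem_univ, true_imp_iff]
        exact ⟨fun h a b => iff_of_eq (congrFun (congrFun h a) b),
          fun h => funext fun a => funext fun b => propext (h a b)⟩
      rw [this]
      exact h.measure_tiePattern_eq hθ h' x₀ _
    · have : g ⁻¹' {p} = ∅ := Set.eq_empty_of_forall_notMem fun x hx => hp ⟨x, hx⟩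
      simp [this]
  have hWg : W = g ⁻¹' (g '' W) := by
    refine (Set.subset_preimage_image g _).antisymm ?_
    rintro x ⟨y, hy, hxy⟩
    exact hW y x (fun a b => iff_of_eq (congrFun (congrFun hxy a) b)) hy
  rw [hWg, ← Measure.map_apply hg (Set.toFinite _).measurableSet, hmap,
    Measure.map_apply hg (Set.toFinite _).measurableSet]

end Urn

/-! ### One draw for each block of ties -/

section Blocks

variable {ι α β E : Type*} [MeasurableSpace E]

open Classical in
/-- The product over the blocks of `K` on `S` of the measure of the intersection of the sets of the
block. -/
noncomputable def blockProd (r : Measure E) (S : Finset ι) (K : ι → α) (A : ι → Set E) : ℝ≥0∞ :=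
  ∏ q ∈ S.image K, r (⋂ u ∈ S.filter fun u => K u = q, A u)

-- Indexing the product by the blocks themselves shows that the names of the values of `K` are
-- irrelevant.
open Classical in
theorem blockProd_eq_prod_blocks (r : Measure E) (S : Finset ι) (K : ι → α) (A : ι → Set E) :
    blockProd r S K A =
      ∏ B ∈ S.image (fun u => S.filter fun u' => K u' = K u), r (⋂ u ∈ B, A u) := by
  have himg : S.image (fun u => S.filter fun u' => K u' = K u) =
      (S.image K).image fun q => S.filter fun u' => K u' = q := by
    rw [Finset.image_image]
    rfl
  rw [himg, Finset.prod_image]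
  · rfl
  · intro q hq q' hq' hqq
    obtain ⟨a, ha, rfl⟩ := Finset.mem_image.1 hq
    have h0 : a ∈ S.filter fun u' => K u' = K a := Finset.mem_filter.2 ⟨ha, rfl⟩
    have hqq : (S.filter fun u' => K u' = K a) = S.filter fun u' => K u' = q' := hqq
    rw [hqq] at h0
    exact (Finset.mem_filter.1 h0).2

theorem blockProd_congr {r : Measure E} {S : Finset ι} {K : ι → α} {K' : ι → β}
    {A : ι → Set E} (h : ∀ a ∈ S, ∀ b ∈ S, K a = K b ↔ K' a = K' b) :
    blockProd r S K A = blockProd r S K' A := by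
  classical
  rw [blockProd_eq_prod_blocks, blockProd_eq_prod_blocks]
  congr 1
  refine Finset.image_congr fun a ha => ?_
  exact Finset.filter_congr fun b hb => h b hb a ha

/-- This and `blockProd_insert_old` match the two kinds of terms in the urn: a new block brings its
own factor, and a point joining a block shrinks the set of a member. -/
theorem blockProd_insert_new [DecidableEq ι] {r : Measure E} {S : Finset ι} {K : ι → α} {v : ι}
    {A : ι → Set E} (h : ∀ u ∈ S, K u ≠ K v) :
    blockProd r (insert v S) K A = r (A v) * blockProd r S K A := by
  classical
  unfold blockProd
  have hv : K v ∉ S.image K := fun hv => by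
    obtain ⟨u, hu, huv⟩ := Finset.mem_image.1 hv
    exact h u hu huv
  have hins : (insert v S).image K = insert (K v) (S.image K) := Finset.image_insert ..
  have e1 : (⋂ u ∈ (insert v S).filter fun u => K u = K v, A u) = A v := by
    have : ((insert v S).filter fun u => K u = K v) = {v} := by
      ext u
      simp only [Finset.mem_filter, Finset.mem_insert, Finset.mem_singleton]
      refine ⟨?_, fun hu => ⟨Or.inl hu, by rw [hu]⟩⟩
      rintro ⟨rfl | hu, huv⟩
      · rfl
      · exact absurd huv (h u hu)
    rw [this]
    simp
  rw [hins, Finset.prod_insert hv, e1]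
  congr 1
  refine Finset.prod_congr rfl fun q hq => ?_
  have hq : K v ≠ q := fun hvq => hv (by rwa [hvq])
  rw [Finset.filter_insert, if_neg hq]

theorem blockProd_insert_old [DecidableEq ι] {r : Measure E} {S : Finset ι} {K : ι → α} {u₀ v : ι}
    {A : ι → Set E} (hu₀ : u₀ ∈ S) (h : K u₀ = K v) :
    blockProd r (insert v S) K A =
      blockProd r S K fun u => A u ∩ if u = u₀ then A v else Set.univ := by
  classical
  unfold blockProd
  refine Finset.prod_congr ?_ fun q _ => ?_
  · ext q
    simp only [Finset.mem_image, Finset.mem_insert]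
    constructor
    · rintro ⟨u, rfl | hu, rfl⟩
      · exact ⟨u₀, hu₀, h⟩
      · exact ⟨u, hu, rfl⟩
    · rintro ⟨u, hu, rfl⟩
      exact ⟨u, Or.inr hu, rfl⟩
  · congr 1
    ext x
    simp only [Set.mem_iInter, Finset.mem_filter, Finset.mem_insert, Set.mem_inter_iff]
    constructor
    · rintro hx u ⟨hu, rfl⟩
      refine ⟨hx u ⟨Or.inr hu, rfl⟩, ?_⟩
      split_ifs with huu
      · exact hx v ⟨Or.inl rfl, by rw [huu, h]⟩
      · trivial
    · rintro hx u ⟨rfl | hu, rfl⟩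
      · simpa using (hx u₀ ⟨hu₀, h⟩).2
      · exact (hx u ⟨hu, rfl⟩).1

end Blocks

/-- Sampling from conditionally independent Dirichlet processes with a common random base measure
amounts to sampling one value from the base measure for each block of an urn. -/
theorem IsCondDirichlet.lintegral_prod_eq_blockProd {ι J E T Ω : Type*} [Fintype ι] [DecidableEq ι]
    [Fintype J] [DecidableEq J] [MeasurableSpace E] [MeasurableSpace T] [StandardBorelSpace T]
    [MeasurableSpace Ω] {θ : ℝ} (hθ : 0 < θ) {μ : Measure Ω} [IsProbabilityMeasure μ]
    {R : Ω → Measure E} {P : J → Ω → Measure E} (hR : IsRandomProbability R)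
    (h : IsCondDirichlet θ (fun _ => R) μ P)
    {l : ι → J} {G : J → Measure T} [∀ j, IsProbabilityMeasure (G j)]
    [∀ j, NullSingletonClass (G j)] {ν : Measure (ι → T)} [IsProbabilityMeasure ν]
    (hν : IsUrn θ l G ν) (S : Finset ι) {A : ι → Set E} (hA : ∀ u, MeasurableSet (A u))
    {φ : (J → Measure E) → ℝ≥0∞} (hφ : Measurable φ) :
    ∫⁻ ω, φ (fun _ => R ω) * ∏ u ∈ S, P (l u) ω (A u) ∂μ =
      ∫⁻ t, ∫⁻ ω, φ (fun _ => R ω) * blockProd (R ω) S (fun u => (l u, t u)) A ∂μ ∂ν := by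
  -- Both sides obey the urn recursion. Fresh draws multiply `φ` by the base mass of `A v`, and
  -- copies replace `A u'` by `A u' ∩ A v`; hence the generalization over both.
  induction S using Finset.induction_on generalizing A φ with
  | empty => simp [blockProd]
  | insert v S hv ih =>
    have hφR : Measurable fun ω => φ fun _ => R ω :=
      hφ.comp (measurable_pi_iff.2 fun _ => hR.measurable)
    have hne : ∀ a ∈ S, a ≠ v := fun a ha => ne_of_mem_of_not_mem ha hv
    have hF : Measurable fun t : ι → T => ∫⁻ ω, φ (fun _ => R ω) *
        blockProd (R ω) (insert v S) (fun u => (l u, t u)) A ∂μ :=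
      measurable_of_ker fun x y hxy => by
        refine lintegral_congr fun ω => ?_
        rw [blockProd_congr (K' := fun u => (l u, y u)) fun a _ b _ => by
          simp only [Prod.mk.injEq, hxy a b]]
    have hstep := h.moment_step hθ hφ l S hA (l v) (hA v)
    have hurn := hν.lintegral_eq hv hF
      (F₀ := fun t => ∫⁻ ω, (φ (fun _ => R ω) * R ω (A v)) *
        blockProd (R ω) S (fun u => (l u, t u)) A ∂μ)
      (fun x y hxy => by
        refine lintegral_congr fun ω => ?_
        rw [blockProd_congr (K' := fun u => (l u, y u)) fun a ha b hb => by
          simp only [Prod.mk.injEq, hxy a ha, hxy b hb]])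
      (fun x y hxy => by
        refine lintegral_congr fun ω => ?_
        rw [blockProd_insert_new (fun u hu hK => ?_), mul_assoc]
        · congr 2
          refine blockProd_congr fun a ha b hb => ?_
          simp only [Function.update_of_ne (hne a ha), Function.update_of_ne (hne b hb)]
        · simp only [Prod.mk.injEq, Function.update_self, Function.update_of_ne (hne u hu)] at hK
          exact hxy u hK.2)
    have hφ' : Measurable fun β : J → Measure E => φ β * β (l v) (A v) :=
      hφ.mul (measurable_eval_measure (hA v) (l v))
    have ih1 := ih hA hφ'
    have ih2 : ∀ u' ∈ S.filter fun u => l u = l v, ∫⁻ ω, φ (fun _ => R ω) *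
        ∏ u ∈ S, P (l u) ω (A u ∩ if u = u' then A v else Set.univ) ∂μ =
        ∫⁻ t, ∫⁻ ω, φ (fun _ => R ω) * blockProd (R ω) (insert v S)
          (fun u => (l u, Function.update t v (t u') u)) A ∂μ ∂ν := by
      intro u' hu'
      obtain ⟨hu'S, hlu'⟩ := Finset.mem_filter.1 hu'
      rw [ih (fun u => (hA u).inter (by split_ifs; exacts [hA v, MeasurableSet.univ])) hφ]
      refine lintegral_congr fun t => lintegral_congr fun ω => ?_
      rw [blockProd_insert_old hu'S (by
        simp [Function.update_of_ne (hne u' hu'S), hlu'])]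
      congr 1
      refine blockProd_congr fun a ha b hb => ?_
      simp only [Function.update_of_ne (hne a ha), Function.update_of_ne (hne b hb)]
    rw [Finset.sum_congr rfl ih2, ih1, ← hurn] at hstep
    -- The two recursions carry the same coefficient, nonzero because `θ > 0`, and it cancels.
    rw [ENNReal.mul_right_inj (by simp [hθ]) (by simp)] at hstep
    simp only [Finset.prod_insert hv]
    exact hstep

/-! ### From conditional expectations to integral identities -/

section Conditional

variable {Ω E : Type*} [MeasurableSpace E]

theorem measure_inter_eq_setLIntegral_of_condProb {m : MeasurableSpace Ω} [mΩ : MeasurableSpace Ω]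
    (hm : m ≤ mΩ)
    {μ : Measure Ω} [IsProbabilityMeasure μ] {X : Set Ω} (hX : MeasurableSet X) {f : Ω → ℝ}
    (hf : ∀ ω, 0 ≤ f ω) (h : μ⟦X | m⟧ =ᵐ[μ] f) {D : Set Ω} (hD : MeasurableSet[m] D) :
    μ (D ∩ X) = ∫⁻ ω in D, ENNReal.ofReal (f ω) ∂μ := by
  have hint : Integrable (X.indicator fun _ => (1 : ℝ)) μ :=
    (integrable_const 1).indicator hX
  have h1 := setIntegral_condExp hm hint hD
  rw [setIntegral_congr_ae (hm _ hD) (h.mono fun ω hω _ => hω), setIntegral_indicator hX,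
    setIntegral_const, smul_eq_mul, mul_one] at h1
  have hfi : Integrable f μ := integrable_condExp.congr h
  rw [← ofReal_integral_eq_lintegral_ofReal hfi.integrableOn (ae_of_all _ hf), h1,
    ofReal_measureReal]

theorem IsConditionalSample.measure_inter {ι : Type*} {m : MeasurableSpace Ω} [mΩ : MeasurableSpace Ω]
    (hm : m ≤ mΩ)
    {μ : Measure Ω} [IsProbabilityMeasure μ] {R : ι → Ω → Measure E} {ξ : ι → Ω → E}
    (hR : ∀ i ω, IsProbabilityMeasure (R i ω)) (h : IsConditionalSample m μ R ξ) (S : Finset ι)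
    {A : ι → Set E} (hA : ∀ i, MeasurableSet (A i)) {D : Set Ω} (hD : MeasurableSet[m] D) :
    μ (D ∩ ⋂ i ∈ S, ξ i ⁻¹' A i) = ∫⁻ ω in D, ∏ i ∈ S, R i ω (A i) ∂μ := by
  rw [measure_inter_eq_setLIntegral_of_condProb hm
    (S.measurableSet_biInter fun i _ => h.measurable i (hA i))
    (fun ω => Finset.prod_nonneg fun i _ => measureReal_nonneg) (h.conditional_law S A hA) hD]
  refine lintegral_congr fun ω => ?_
  rw [ENNReal.ofReal_prod_of_nonneg fun i _ => measureReal_nonneg]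
  exact Finset.prod_congr rfl fun i _ => ofReal_measureReal

theorem IsConditionalSample.isSampleLaw {ι : Type*} [Fintype ι] {m : MeasurableSpace Ω}
    [mΩ : MeasurableSpace Ω] (hm : m ≤ mΩ) {μ : Measure Ω} [IsProbabilityMeasure μ] {R : ι → Ω → Measure E}
    {ξ : ι → Ω → E} (hR : ∀ i ω, IsProbabilityMeasure (R i ω)) (h : IsConditionalSample m μ R ξ) :
    IsSampleLaw μ R (μ.map fun ω i => ξ i ω) := by
  intro A hA
  rw [Measure.map_apply (measurable_pi_iff.2 h.measurable) (MeasurableSet.univ_pi hA)]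
  have := h.measure_inter hm hR Finset.univ hA MeasurableSet.univ
  rw [Set.univ_inter, Measure.restrict_univ] at this
  rw [← this]
  congr 1
  ext ω
  simp

variable [MeasurableSpace Ω] {J : Type*} [Fintype J]

theorem IsDirichletProcess.isCondDirichlet {θ : ℝ} {μ : Measure Ω} [IsProbabilityMeasure μ]
    {G : J → Measure E} [∀ j, IsProbabilityMeasure (G j)] {P : J → Ω → Measure E}
    (hP : ∀ j, IsDirichletProcess θ (G j) μ (P j)) (hind : iIndepFun P μ) :
    IsCondDirichlet θ (fun j _ => G j) μ P where
  base j := ⟨measurable_const, fun _ => inferInstance⟩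
  random j := (hP j).toIsRandomProbability
  law k A hA D _ C hC := by
    have hv : ∀ j, Measurable fun (ω : Ω) a => (P j ω).real (A a) := fun j =>
      measurable_pi_iff.2 fun a => (hP j).toIsRandomProbability.measurable_real (hA.measurableSet a)
    -- The base measures are deterministic, so the event for them is either everything or empty.
    by_cases hD : (fun j => G j) ∈ D
    · simp only [hD, Set.ofPred_true, Set.univ_inter, Measure.restrict_univ, lintegral_const,
        measure_univ, mul_one]
      have : ∀ j, MeasurableSet[MeasurableSpace.comap (P j) inferInstance]
          {ω | (fun a => (P j ω).real (A a)) ∈ C j} := fun j => by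
        refine ⟨(fun p : Measure E => fun a => p.real (A a)) ⁻¹' C j, ?_, rfl⟩
        exact (measurable_pi_iff.2 fun a =>
          (Measure.measurable_coe (hA.measurableSet a)).ennreal_toReal) (hC j)
      rw [hind.meas_iInter this]
      refine Finset.prod_congr rfl fun j _ => ?_
      rw [← (hP j).law k A hA, Measure.map_apply (hv j) (hC j)]
      rfl
    · simp [hD]

theorem IsHDP.isCondDirichlet {d : ℕ} {θ θ₀ : ℝ} {P₀ : Measure E} {μ : Measure Ω}
    [IsProbabilityMeasure μ] {R : Ω → Measure E} {P : Fin d → Ω → Measure E}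
    (h : IsHDP θ θ₀ P₀ μ R P) : IsCondDirichlet θ (fun _ => R) μ P where
  base _ := h.root.toIsRandomProbability
  random := h.random
  law k A hA D hD C hC := by
    have hR := h.root.measurable
    have hv : ∀ j, Measurable fun (ω : Ω) a => (P j ω).real (A a) := fun j =>
      measurable_pi_iff.2 fun a => (h.random j).measurable_real (hA.measurableSet a)
    refine (measure_inter_eq_setLIntegral_of_condProb hR.comap_le
      (MeasurableSet.iInter fun j => hv j (hC j))
      (fun ω => Finset.prod_nonneg fun j _ => measureReal_nonneg)
      (h.conditional_law k A hA C hC)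
      ⟨(fun r _ => r) ⁻¹' D, (measurable_pi_iff.2 fun _ => measurable_id) hD, rfl⟩).trans ?_
    refine lintegral_congr fun ω => ?_
    rw [ENNReal.ofReal_prod_of_nonneg fun i _ => measureReal_nonneg]
    exact Finset.prod_congr rfl fun i _ => ofReal_measureReal

end Conditional

/-! ### Representatives of blocks -/

section Representatives

variable {ι α β : Type*} [LinearOrder ι]

open Classical in
/-- The first place in `S` where `K` takes the value `K u`, and `u` itself if there is none. -/
noncomputable def rep (S : Finset ι) (K : ι → α) (u : ι) : ι :=
  if h : (S.filter fun u' => K u' = K u).Nonempty then (S.filter fun u' => K u' = K u).min' h else u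

theorem rep_congr {S : Finset ι} {K : ι → α} {K' : ι → β} {u : ι}
    (h : ∀ a ∈ S, K a = K u ↔ K' a = K' u) : rep S K u = rep S K' u := by
  classical
  unfold rep
  have : (S.filter fun u' => K u' = K u) = S.filter fun u' => K' u' = K' u := by
    ext a
    simp only [Finset.mem_filter]
    exact and_congr_right fun ha => h a ha
  simp only [this]

theorem rep_congr_value {S : Finset ι} {K : ι → α} {a b : ι} (hb : b ∈ S) (h : K a = K b) :
    rep S K a = rep S K b := by
  classical
  have hne : (S.filter fun u' => K u' = K b).Nonempty := ⟨b, by simp [hb]⟩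
  unfold rep
  simp only [h, dif_pos hne]

theorem apply_rep (S : Finset ι) (K : ι → α) (u : ι) : K (rep S K u) = K u := by
  classical
  unfold rep
  split_ifs with h
  · exact (Finset.mem_filter.1 (Finset.min'_mem _ h)).2
  · rfl

theorem rep_mem {S : Finset ι} {K : ι → α} {u : ι} (hu : u ∈ S) : rep S K u ∈ S := by
  classical
  have hne : (S.filter fun u' => K u' = K u).Nonempty := ⟨u, by simp [hu]⟩
  unfold rep
  rw [dif_pos hne]
  exact (Finset.mem_filter.1 (Finset.min'_mem _ hne)).1

theorem rep_of_new {S : Finset ι} {K : ι → α} {u : ι} (hu : ∀ a ∈ S, K a ≠ K u) :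
    rep S K u = u := by
  classical
  unfold rep
  rw [dif_neg]
  rintro ⟨a, ha⟩
  exact hu a (Finset.mem_filter.1 ha).1 (Finset.mem_filter.1 ha).2

/-- A point outside `S` whose value is absent from `S` represents itself. The hypothesis excludes
two distinct such points, which could share a value without sharing a representative. -/
theorem rep_eq_rep_iff {S : Finset ι} {K : ι → α} {a b : ι} (h : a ∉ S → b ∉ S → a = b) :
    rep S K a = rep S K b ↔ K a = K b := by
  refine ⟨fun hab => by
    rw [← apply_rep S K a, hab, apply_rep S K b], fun hab => ?_⟩
  by_cases hb : b ∈ S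
  · exact rep_congr_value hb hab
  · by_cases ha : a ∈ S
    · exact (rep_congr_value ha hab.symm).symm
    · rw [h ha hb]

end Representatives

/-! ### Root samples indexed by the nodes -/

section SampleLaw

variable {ι E Ω : Type*} [Fintype ι] [MeasurableSpace E] [MeasurableSpace Ω]

theorem measure_ext_of_prod_pi {X : Type*} [MeasurableSpace X] {m m' : Measure (X × (ι → E))}
    [IsFiniteMeasure m] (h : ∀ D : Set X, MeasurableSet D → ∀ A : ι → Set E,
      (∀ i, MeasurableSet (A i)) → m (D ×ˢ Set.univ.pi A) = m' (D ×ˢ Set.univ.pi A)) : m = m' := by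
  classical
  refine Measure.ext_prod fun {D B} hD hB => ?_
  have hDu : MeasurableSet (D ×ˢ (Set.univ : Set (ι → E))) := hD.prod .univ
  have aux : ∀ (m : Measure (X × (ι → E))) (B : Set (ι → E)), MeasurableSet B →
      m (D ×ˢ B) = (m.restrict (D ×ˢ Set.univ)).map Prod.snd B := fun m B hB => by
    rw [Measure.map_apply measurable_snd hB, Measure.restrict_apply (measurable_snd hB)]
    congr 1
    ext p
    simp [and_comm]
  rw [aux m B hB, aux m' B hB]
  congr 1
  refine measure_ext_of_pi fun A hA => ?_
  rw [← aux m _ (MeasurableSet.univ_pi hA), ← aux m' _ (MeasurableSet.univ_pi hA)]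
  exact h D hD A hA

/-- The event is a rectangle in `y`, whose side at `q` is the intersection of the `A u` over the
fibre of `K` at `q`. -/
theorem IsSampleLaw.measure_comp {μ : Measure Ω} {R : Ω → Measure E}
    (hR : IsRandomProbability R) {ν : Measure (ι → E)} (h : IsSampleLaw μ (fun _ => R) ν)
    (K : ι → ι) {A : ι → Set E} (hA : ∀ u, MeasurableSet (A u)) :
    ν {y | ∀ u, y (K u) ∈ A u} = ∫⁻ ω, blockProd (R ω) Finset.univ K A ∂μ := by
  classical
  have := hR.isProbabilityMeasure
  have hset : {y : ι → E | ∀ u, y (K u) ∈ A u} =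
      Set.univ.pi fun q => ⋂ u ∈ Finset.univ.filter (fun u => K u = q), A u := by
    ext y
    simp only [Set.mem_ofPred_eq, Set.mem_pi, Set.mem_univ, true_imp_iff, Set.mem_iInter,
      Finset.mem_filter, Finset.mem_univ, true_and]
    exact ⟨fun hy q u hu => hu ▸ hy u, fun hy u => hy _ u rfl⟩
  rw [hset, h _ fun q => Finset.measurableSet_biInter _ fun u _ => hA u]
  refine lintegral_congr fun ω => ?_
  rw [blockProd]
  refine (Finset.prod_subset (Finset.subset_univ _) fun q _ hq => ?_).symm
  have : Finset.univ.filter (fun u => K u = q) = ∅ :=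
    Finset.filter_eq_empty_iff.2 fun u _ hu => hq (Finset.mem_image.2 ⟨u, Finset.mem_univ _, hu⟩)
  simp [this]

theorem exists_isSampleLaw {μ : Measure Ω} [IsProbabilityMeasure μ] {R : Ω → Measure E}
    (hR : IsRandomProbability R) : ∃ ν : Measure (ι → E), IsSampleLaw μ (fun _ => R) ν := by
  have := hR.isProbabilityMeasure
  have hm : Measurable fun ω => Measure.pi fun _ : ι => R ω :=
    measurable_measure_pi fun _ => hR.measurable
  refine ⟨μ.bind fun ω => Measure.pi fun _ : ι => R ω, fun A hA => ?_⟩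
  rw [Measure.bind_apply (MeasurableSet.univ_pi hA) hm.aemeasurable]
  simp only [Measure.pi_pi]

theorem IsDirichletProcess.isUrn [DecidableEq ι] {θ : ℝ} (hθ : 0 < θ) {μ : Measure Ω}
    [IsProbabilityMeasure μ] {P₀ : Measure E} [IsProbabilityMeasure P₀] {R : Ω → Measure E}
    (hR : IsDirichletProcess θ P₀ μ R) {ν : Measure (ι → E)}
    (hν : IsSampleLaw μ (fun _ => R) ν) : IsUrn θ (fun _ => ()) (fun _ => P₀) ν :=
  have hc : IsCondDirichlet θ (fun (_ : Unit) _ => P₀) μ fun _ => R :=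
    IsDirichletProcess.isCondDirichlet (G := fun _ : Unit => P₀) (fun _ => hR)
      iIndepFun.of_subsingleton
  IsSampleLaw.isUrn (l := fun _ => ()) hθ hc hν

end SampleLaw

/-! ### Reading profiles at subgroup representatives -/

section Join

variable {d : ℕ} {V : Fin d → ℕ} {E T : Type*}

/-- The first node in `S` of the subgroup of `u`. -/
noncomputable def subgroupRep (S : Finset (Node V)) (t : Node V → T) (u : Node V) : Node V :=
  rep S (fun u => (layer u, t u)) u

/-- Give the nodes of each subgroup the profile drawn at the representative of the subgroup. -/
noncomputable def joinProfiles (S : Finset (Node V)) (p : (Node V → T) × (Node V → E)) :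
    (Node V → T) × (Node V → E) :=
  (p.1, fun u => p.2 (subgroupRep S p.1 u))

theorem subgroupRep_eq_iff {S : Finset (Node V)} (hS : ∀ a b, a ∉ S → b ∉ S → a = b)
    {t : Node V → T} {a b : Node V} :
    subgroupRep S t a = subgroupRep S t b ↔ layer a = layer b ∧ t a = t b := by
  rw [subgroupRep, subgroupRep, rep_eq_rep_iff (hS a b), Prod.mk.injEq]

theorem layer_subgroups_eq_iff {t : Node V → T} {a b : Node V} :
    (layer a, subgroups t a) = (layer b, subgroups t b) ↔ layer a = layer b ∧ t a = t b := by
  rw [Prod.mk.injEq]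
  exact and_congr_right fun h => subgroups_eq_iff h

variable [MeasurableSpace E] [MeasurableSpace T] [StandardBorelSpace T]

theorem measurable_joinProfiles (S : Finset (Node V)) :
    Measurable (joinProfiles (T := T) (E := E) S) := by
  refine measurable_fst.prodMk (measurable_pi_iff.2 fun u => fun A hA => ?_)
  have : (fun p : (Node V → T) × (Node V → E) => p.2 (subgroupRep S p.1 u)) ⁻¹' A =
      ⋃ k, {t | subgroupRep S t u = k} ×ˢ {y | y k ∈ A} := by
    ext p
    simp
  rw [this]
  -- On each piece the representative is a fixed node `k`, and which node it is depends only on the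
  -- ties of `t`.
  refine MeasurableSet.iUnion fun k => MeasurableSet.prod ?_ (measurable_pi_apply k hA)
  refine measurableSet_setOfPred.2 (measurable_of_ker fun x y hxy => ?_)
  have : subgroupRep S x u = subgroupRep S y u := rep_congr fun a _ => by
    simp only [Prod.mk.injEq, hxy]
  rw [this]

end Join

/-! ### The generative construction as the image of a product measure -/

section Franchise

variable {Ω E T : Type*} [MeasurableSpace Ω] [MeasurableSpace E] [MeasurableSpace T]
  {d : ℕ} {V : Fin d → ℕ} {θ θ₀ : ℝ} {P₀ : Measure E} {G : Fin d → Measure T}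
  {μ : Measure Ω} [IsProbabilityMeasure μ] {R : Ω → Measure E} {Q : Fin d → Ω → Measure T}
  {t : Node V → Ω → T} {s : Fin d × ℕ → Ω → E}

omit [IsProbabilityMeasure μ] in
theorem IsFranchise.measurable_roots (hM : IsFranchise V θ θ₀ P₀ G μ R Q t s) :
    Measurable fun ω => (R ω, fun j => Q j ω) :=
  hM.root.measurable.prodMk (measurable_pi_iff.2 fun j => (hM.layers j).measurable)

omit [IsProbabilityMeasure μ] in
theorem IsFranchise.measurable_subgroups (hM : IsFranchise V θ θ₀ P₀ G μ R Q t s) :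
    Measurable fun ω u => t u ω :=
  measurable_pi_iff.2 hM.sample_subgroups.measurable

omit [IsProbabilityMeasure μ] in
theorem IsFranchise.measurable_all (hM : IsFranchise V θ θ₀ P₀ G μ R Q t s) :
    Measurable fun ω => (R ω, (fun j => Q j ω), fun u => t u ω) :=
  hM.root.measurable.prodMk ((measurable_pi_iff.2 fun j => (hM.layers j).measurable).prodMk
    hM.measurable_subgroups)

theorem IsFranchise.isSampleLaw_subgroups (hM : IsFranchise V θ θ₀ P₀ G μ R Q t s) :
    IsSampleLaw μ (fun u => Q (layer u)) (μ.map fun ω u => t u ω) :=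
  hM.sample_subgroups.isSampleLaw hM.measurable_roots.comap_le
    fun u => (hM.layers (layer u)).isProbabilityMeasure

theorem IsFranchise.isUrn_subgroups (hM : IsFranchise V θ θ₀ P₀ G μ R Q t s) (hθ : 0 < θ)
    [∀ j, IsProbabilityMeasure (G j)] :
    IsUrn θ layer G (μ.map fun ω u => t u ω) :=
  hM.isSampleLaw_subgroups.isUrn hθ
    (IsDirichletProcess.isCondDirichlet hM.layers hM.indep_layers)

/-- Given the root and the layers, the law of the subgroup variables involves only the layers, which
are independent of the root. -/
theorem IsFranchise.indepFun_root_subgroups (hM : IsFranchise V θ θ₀ P₀ G μ R Q t s) :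
    IndepFun R (fun ω u => t u ω) μ := by
  have hR := hM.root.measurable
  have ht := hM.measurable_subgroups
  have := Measure.isProbabilityMeasure_map (μ := μ) (hR.prodMk ht).aemeasurable
  rw [indepFun_iff_map_prod_eq_prod_map_map hR.aemeasurable ht.aemeasurable]
  refine measure_ext_of_prod_pi fun D hD A hA => ?_
  have hQ : ∀ j ω, IsProbabilityMeasure (Q j ω) := fun j => (hM.layers j).isProbabilityMeasure
  have hpi := MeasurableSet.univ_pi hA
  rw [Measure.map_apply (hR.prodMk ht) (hD.prod hpi), Measure.prod_prod, Measure.map_apply hR hD,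
    hM.isSampleLaw_subgroups A hA]
  have h1 := hM.sample_subgroups.measure_inter hM.measurable_roots.comap_le
    (fun u => hQ (layer u)) Finset.univ hA (D := R ⁻¹' D) ⟨Prod.fst ⁻¹' D, measurable_fst hD, rfl⟩
  have hset : (fun ω => (R ω, fun u => t u ω)) ⁻¹' D ×ˢ Set.univ.pi A =
      R ⁻¹' D ∩ ⋂ u ∈ Finset.univ, t u ⁻¹' A u := by
    ext ω
    simp
  have hm1 : Measurable (D.indicator (1 : Measure E → ℝ≥0∞)) := measurable_one.indicator hD
  have hm2 : Measurable fun q : Fin d → Measure T => ∏ u : Node V, q (layer u) (A u) :=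
    Finset.measurable_prod _ fun u _ => measurable_eval_measure (hA u) (layer u)
  have h2 := lintegral_mul_eq_lintegral_mul_lintegral_of_indepFun (hm1.comp hR)
    (hm2.comp (measurable_pi_iff.2 fun j => (hM.layers j).measurable))
    (hM.indep_root.comp hm1 hm2)
  have h3 : ∫⁻ ω, (D.indicator (1 : Measure E → ℝ≥0∞) ∘ R) ω ∂μ = μ (R ⁻¹' D) := by
    rw [← lintegral_indicator_one (hR hD)]
    rfl
  rw [h3] at h2
  rw [hset, h1, ← lintegral_indicator (hR hD)]
  refine Eq.trans (lintegral_congr fun ω => ?_) h2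
  by_cases hω : R ω ∈ D <;> simp [Set.indicator, hω]

/-- Given everything else, the profiles at a fixed index map `K` contribute `blockProd (R ω)`, a
function of the root alone, and the root is independent of the subgroup variables. -/
theorem IsFranchise.measure_inter (hM : IsFranchise V θ θ₀ P₀ G μ R Q t s)
    {D : Set (Node V → T)} (hD : MeasurableSet D) (K : Node V → Fin d × ℕ) {A : Node V → Set E}
    (hA : ∀ u, MeasurableSet (A u)) :
    μ ((fun ω u => t u ω) ⁻¹' D ∩ {ω | ∀ u, s (K u) ω ∈ A u}) =
      μ ((fun ω u => t u ω) ⁻¹' D) * ∫⁻ ω, blockProd (R ω) Finset.univ K A ∂μ := by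
  classical
  have ht := hM.measurable_subgroups
  have hR := hM.root.toIsRandomProbability
  have h1 := hM.sample_profiles.measure_inter hM.measurable_all.comap_le
    (fun _ => hM.root.isProbabilityMeasure) (Finset.univ.image K)
    (A := fun q => ⋂ u ∈ Finset.univ.filter (fun u => K u = q), A u)
    (fun q => Finset.measurableSet_biInter _ fun u _ => hA u)
    (D := (fun ω u => t u ω) ⁻¹' D)
    ⟨(fun p : Measure E × (Fin d → Measure T) × (Node V → T) => p.2.2) ⁻¹' D,
      (measurable_snd.comp measurable_snd) hD, rfl⟩
  have hset : {ω | ∀ u, s (K u) ω ∈ A u} = ⋂ q ∈ Finset.univ.image K,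
      s q ⁻¹' ⋂ u ∈ Finset.univ.filter (fun u => K u = q), A u := by
    ext ω
    simp only [Set.mem_ofPred_eq, Set.mem_iInter, Finset.mem_image, Finset.mem_univ, true_and,
      Set.mem_preimage, Finset.mem_filter]
    constructor
    · rintro h q - u rfl
      exact h u
    · intro h u
      exact h (K u) ⟨u, rfl⟩ u rfl
  have hg : Measurable fun r : Measure E => blockProd r Finset.univ K A :=
    Finset.measurable_prod _ fun q _ => Measure.measurable_coe
      (Finset.measurableSet_biInter _ fun u _ => hA u)
  have hm1 : Measurable (D.indicator (1 : (Node V → T) → ℝ≥0∞)) := measurable_one.indicator hD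
  have h2 := lintegral_mul_eq_lintegral_mul_lintegral_of_indepFun (hm1.comp ht)
    (hg.comp hR.measurable) (hM.indepFun_root_subgroups.symm.comp hm1 hg)
  have h3 : ∫⁻ ω, (D.indicator (1 : (Node V → T) → ℝ≥0∞) ∘ fun ω u => t u ω) ω ∂μ =
      μ ((fun ω u => t u ω) ⁻¹' D) := by
    rw [← lintegral_indicator_one (ht hD)]
    rfl
  rw [h3] at h2
  rw [hset, h1, ← lintegral_indicator (ht hD)]
  refine Eq.trans (lintegral_congr fun ω => ?_) h2
  by_cases hω : (fun u => t u ω) ∈ D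
  · simp only [Set.indicator, Set.mem_preimage, hω, if_true, Pi.mul_apply, Function.comp_apply,
      Pi.one_apply, one_mul, blockProd]
    congr!
  · simp [Set.indicator, hω]

variable [StandardBorelSpace T]

theorem measurable_subgroups_fun : Measurable (subgroups : (Node V → T) → Node V → ℕ) :=
  measurable_of_ker fun x y hxy => by
    funext u
    exact label_congr fun a _ b _ => hxy a b

omit [IsProbabilityMeasure μ] in
theorem IsFranchise.measurable_profiles (hM : IsFranchise V θ θ₀ P₀ G μ R Q t s) :
    Measurable fun ω => profiles (fun u => t u ω) fun p => s p ω := by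
  refine measurable_pi_iff.2 fun u => fun A hA => ?_
  have : (fun ω => profiles (fun u => t u ω) (fun p => s p ω) u) ⁻¹' A =
      ⋃ k, {ω | subgroups (fun u => t u ω) u = k} ∩ {ω | s (layer u, k) ω ∈ A} := by
    ext ω
    simp [profiles]
  rw [this]
  refine MeasurableSet.iUnion fun k => MeasurableSet.inter ?_
    (hM.sample_profiles.measurable (layer u, k) hA)
  exact ((measurable_pi_iff.1 measurable_subgroups_fun u).comp hM.measurable_subgroups)
    (measurableSet_singleton k)

/-- Profiles indexed by subgroup labels and root draws indexed by representatives have the same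
blocks, hence the same `blockProd`. `S` may miss one node: the full set serves for (i), the
complement of `v` for (ii). -/
theorem IsFranchise.map_eq (hM : IsFranchise V θ θ₀ P₀ G μ R Q t s)
    {S : Finset (Node V)} (hS : ∀ a b, a ∉ S → b ∉ S → a = b)
    {ν : Measure (Node V → E)} (hν : IsSampleLaw μ (fun _ => R) ν) :
    μ.map (fun ω => ((fun u => t u ω), profiles (fun u => t u ω) fun p => s p ω)) =
      ((μ.map fun ω u => t u ω).prod ν).map (joinProfiles S) := by
  have ht := hM.measurable_subgroups
  have htx := ht.prodMk hM.measurable_profiles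
  have hR := hM.root.toIsRandomProbability
  have := Measure.isProbabilityMeasure_map (μ := μ) htx.aemeasurable
  have := hν.isProbabilityMeasure fun _ => hR.isProbabilityMeasure
  refine measure_ext_of_prod_pi fun D hD A hA => ?_
  have hpi := MeasurableSet.univ_pi hA
  set B : (Node V → ℕ) → ℝ≥0∞ := fun η =>
    ∫⁻ ω, blockProd (R ω) Finset.univ (fun u => (layer u, η u)) A ∂μ with hB
  rw [Measure.map_apply htx (hD.prod hpi), Measure.map_apply (measurable_joinProfiles S)
    (hD.prod hpi), Measure.prod_apply (measurable_joinProfiles S (hD.prod hpi))]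
  have hright : ∀ τ : Node V → T, ν (Prod.mk τ ⁻¹' (joinProfiles S ⁻¹' D ×ˢ Set.univ.pi A)) =
      D.indicator (fun τ => B (subgroups τ)) τ := by
    intro τ
    by_cases hτ : τ ∈ D
    · have : Prod.mk τ ⁻¹' (joinProfiles S ⁻¹' D ×ˢ Set.univ.pi A) =
          {y | ∀ u, y (subgroupRep S τ u) ∈ A u} := by
        ext y
        simp [joinProfiles, hτ]
      rw [this, hν.measure_comp hR _ hA, Set.indicator_of_mem hτ]
      refine lintegral_congr fun ω => blockProd_congr fun a _ b _ => ?_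
      rw [subgroupRep_eq_iff hS, layer_subgroups_eq_iff]
    · have : Prod.mk τ ⁻¹' (joinProfiles S ⁻¹' D ×ˢ Set.univ.pi A) = ∅ := by
        ext y
        simp [joinProfiles, hτ]
      rw [this, measure_empty, Set.indicator_of_notMem hτ]
  simp_rw [hright]
  have hsub := fun η => measurable_subgroups_fun (V := V) (T := T) (measurableSet_singleton η)
  have hDη := fun η => hD.inter (hsub η)
  -- Split along the countably many label vectors `η`; on each piece the index `(layer u, η u)` is
  -- deterministic, as `measure_inter` requires.
  have hdisj : Pairwise (Function.onFun Disjoint fun η => D ∩ subgroups (T := T) ⁻¹' {η}) := by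
    intro η η' hηη
    refine Set.disjoint_left.2 fun τ h1 h2 => hηη ?_
    rw [← h1.2, ← h2.2]
  have hDU : D = ⋃ η, D ∩ subgroups (T := T) ⁻¹' {η} := by
    ext τ
    simp
  rw [lintegral_indicator hD]
  conv_rhs => rw [hDU]
  rw [lintegral_iUnion hDη hdisj]
  have hleft : (fun ω => ((fun u => t u ω), profiles (fun u => t u ω) fun p => s p ω)) ⁻¹'
      D ×ˢ Set.univ.pi A = ⋃ η, ((fun ω u => t u ω) ⁻¹' (D ∩ subgroups (T := T) ⁻¹' {η}) ∩
        {ω | ∀ u, s (layer u, η u) ω ∈ A u}) := by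
    ext ω
    simp only [Set.mem_preimage, Set.mem_prod, Set.mem_pi, Set.mem_univ, true_imp_iff,
      Set.mem_iUnion, Set.mem_inter_iff, Set.mem_singleton_iff, Set.mem_ofPred_eq, profiles]
    constructor
    · rintro ⟨h1, h2⟩
      exact ⟨_, ⟨h1, rfl⟩, h2⟩
    · rintro ⟨η, ⟨h1, rfl⟩, h2⟩
      exact ⟨h1, h2⟩
  rw [hleft, measure_iUnion]
  · refine tsum_congr fun η => ?_
    rw [hM.measure_inter (hDη η) (fun u => (layer u, η u)) hA,
      setLIntegral_congr_fun (hDη η) (g := fun _ => B η) fun τ hτ => by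
        have : subgroups τ = η := hτ.2
        simp only [this],
      setLIntegral_const, Measure.map_apply ht (hDη η), mul_comm]
  · intro η η' hηη
    refine Disjoint.mono Set.inter_subset_left Set.inter_subset_left ?_
    exact (hdisj hηη).preimage _
  · intro η
    refine (ht (hDη η)).inter ?_
    have : {ω | ∀ u, s (layer u, η u) ω ∈ A u} = ⋂ u, s (layer u, η u) ⁻¹' A u := by
      ext ω
      simp
    rw [this]
    exact MeasurableSet.iInter fun u => hM.sample_profiles.measurable _ (hA u)

end Franchise

/-- The urn law `νt` need not be related to the hierarchical process: any layered urn with the same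
`θ` and diffuse bases gives the right blocks. This permits using the subgroup variables of the other
model. -/
theorem IsHDP.map_eq {Ω' E T : Type*} [MeasurableSpace Ω'] [MeasurableSpace E] [MeasurableSpace T]
    [StandardBorelSpace T] {d : ℕ} {V : Fin d → ℕ} {θ θ₀ : ℝ} (hθ : 0 < θ) {P₀ : Measure E}
    {μ' : Measure Ω'} [IsProbabilityMeasure μ'] {R : Ω' → Measure E} {P : Fin d → Ω' → Measure E}
    {x : Node V → Ω' → E} (h : IsHDP θ θ₀ P₀ μ' R P)
    (hx : IsConditionalSample (MeasurableSpace.comap (fun ω j => P j ω) inferInstance) μ'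
        (fun u => P (layer u)) x)
    {G : Fin d → Measure T} [∀ j, IsProbabilityMeasure (G j)] [∀ j, NullSingletonClass (G j)]
    {νt : Measure (Node V → T)} [IsProbabilityMeasure νt] (hνt : IsUrn θ layer G νt)
    {S : Finset (Node V)} (hS : ∀ a b, a ∉ S → b ∉ S → a = b)
    {ν : Measure (Node V → E)} (hν : IsSampleLaw μ' (fun _ => R) ν) :
    μ'.map (fun ω u => x u ω) = (νt.prod ν).map fun p => (joinProfiles S p).2 := by
  have hR := h.root.toIsRandomProbability
  have hPm : Measurable fun ω j => P j ω := measurable_pi_iff.2 fun j => (h.random j).measurable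
  have hs := hx.isSampleLaw hPm.comap_le fun u => (h.random (layer u)).isProbabilityMeasure
  have := Measure.isProbabilityMeasure_map (μ := μ') (measurable_pi_iff.2 hx.measurable).aemeasurable
  have := hν.isProbabilityMeasure fun _ => hR.isProbabilityMeasure
  refine measure_ext_of_pi fun A hA => ?_
  have hpi := MeasurableSet.univ_pi hA
  have hj : Measurable fun p : (Node V → T) × (Node V → E) => (joinProfiles S p).2 :=
    measurable_snd.comp (measurable_joinProfiles S)
  have key := h.isCondDirichlet.lintegral_prod_eq_blockProd hθ hR hνt Finset.univ hA
    (φ := fun _ => 1) measurable_const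
  simp only [one_mul] at key
  rw [hs A hA, key, Measure.map_apply hj hpi, Measure.prod_apply (hj hpi)]
  refine lintegral_congr fun τ => ?_
  have : Prod.mk τ ⁻¹' ((fun p : (Node V → T) × (Node V → E) => (joinProfiles S p).2) ⁻¹'
      Set.univ.pi A) = {y | ∀ u, y (subgroupRep S τ u) ∈ A u} := by
    ext y
    simp [joinProfiles]
  rw [this, hν.measure_comp hR _ hA]
  refine lintegral_congr fun ω => blockProd_congr fun a _ b _ => ?_
  rw [subgroupRep_eq_iff hS, Prod.mk.injEq]

theorem IsFranchise.allocation_law {Ω E T : Type*} [MeasurableSpace Ω]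
    [MeasurableSpace E] [StandardBorelSpace E] [MeasurableSpace T] [StandardBorelSpace T]
    {μ : Measure Ω} [IsProbabilityMeasure μ]
    {d : ℕ} {V : Fin d → ℕ} {θ θ₀ : ℝ} (hθ : 0 < θ) (hθ₀ : 0 < θ₀)
    {P₀ : Measure E} [IsProbabilityMeasure P₀] [NullSingletonClass P₀]
    {G : Fin d → Measure T} [∀ j, IsProbabilityMeasure (G j)] [∀ j, NullSingletonClass (G j)]
    {R : Ω → Measure E} {Q : Fin d → Ω → Measure T}
    {t : Node V → Ω → T} {s : Fin d × ℕ → Ω → E}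
    (hM : IsFranchise V θ θ₀ P₀ G μ R Q t s)
    {Ω' : Type*} [MeasurableSpace Ω'] {μ' : Measure Ω'} [IsProbabilityMeasure μ']
    {P₀' : Measure E} [IsProbabilityMeasure P₀'] [NullSingletonClass P₀']
    {R' : Ω' → Measure E} {P' : Fin d → Ω' → Measure E} {x' : Node V → Ω' → E}
    (h : IsHDP θ θ₀ P₀' μ' R' P')
    (hx : IsConditionalSample (MeasurableSpace.comap (fun ω j => P' j ω) inferInstance) μ'
        (fun u => P' (layer u)) x') (ζ : Node V → ℕ) :
    μ {ω | allocation (profiles (fun u => t u ω) fun p => s p ω) = ζ} =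
      μ' {ω | allocation (fun u => x' u ω) = ζ} := by
  obtain ⟨ν, hν⟩ := exists_isSampleLaw (ι := Node V) (μ := μ) hM.root.toIsRandomProbability
  obtain ⟨ν', hν'⟩ := exists_isSampleLaw (ι := Node V) (μ := μ') h.root.toIsRandomProbability
  have := hν.isProbabilityMeasure fun _ => hM.root.isProbabilityMeasure
  have := hν'.isProbabilityMeasure fun _ => h.root.isProbabilityMeasure
  have := Measure.isProbabilityMeasure_map (μ := μ) hM.measurable_subgroups.aemeasurable
  have hS : ∀ a b : Node V, a ∉ Finset.univ → b ∉ Finset.univ → a = b :=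
    fun a _ ha => absurd (Finset.mem_univ a) ha
  have e1 := hM.map_eq hS hν
  have e2 := h.map_eq hθ hx (hM.isUrn_subgroups hθ) hS hν'
  have halloc : Measurable (allocation : (Node V → E) → Node V → ℕ) :=
    measurable_of_ker fun x y hxy => by
      funext u
      exact label_congr fun a _ b _ => hxy a b
  have hW : MeasurableSet {x : Node V → E | allocation x = ζ} :=
    halloc (measurableSet_singleton ζ)
  have hj : Measurable fun p : (Node V → T) × (Node V → E) => (joinProfiles Finset.univ p).2 :=
    measurable_snd.comp (measurable_joinProfiles _)
  have f1 : μ {ω | allocation (profiles (fun u => t u ω) fun p => s p ω) = ζ} =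
      (μ.map (fun ω => ((fun u => t u ω), profiles (fun u => t u ω) fun p => s p ω)))
        (Prod.snd ⁻¹' {x : Node V → E | allocation x = ζ}) := by
    rw [Measure.map_apply (hM.measurable_subgroups.prodMk hM.measurable_profiles)
      (measurable_snd hW)]
    rfl
  have f2 : μ' {ω | allocation (fun u => x' u ω) = ζ} =
      (μ'.map fun ω u => x' u ω) {x : Node V → E | allocation x = ζ} := by
    rw [Measure.map_apply (measurable_pi_iff.2 hx.measurable) hW]
    rfl
  rw [f1, f2, e1, e2, Measure.map_apply (measurable_joinProfiles _) (measurable_snd hW),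
    Measure.map_apply hj hW, Measure.prod_apply (measurable_joinProfiles _ (measurable_snd hW)),
    Measure.prod_apply (hj hW)]
  refine lintegral_congr fun τ => ?_
  -- With the subgroup variables fixed at `τ`, the event depends only on ties of the root draws, so
  -- the two base measures give it the same probability.
  refine (hM.root.isUrn hθ₀ hν).measure_eq_of_ker hθ₀ (h.root.isUrn hθ₀ hν') ?_
  intro x y hxy hx
  change allocation (fun u => y (subgroupRep Finset.univ τ u)) = ζ
  have hx : allocation (fun u => x (subgroupRep Finset.univ τ u)) = ζ := hx
  rw [← hx]
  funext u
  exact label_congr fun a _ b _ => (hxy _ _).symm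

/-! ### The effect of resampling one node -/

section RemoveNode

variable {d : ℕ} {V : Fin d → ℕ} {E T : Type*} {v : Node V} {ζ η : Rest v → ℕ}

/-- The event that `t` and `x` induce the subgroups `η` and the profiles `ζ` without node `v`. -/
def restEvent (ζ η : Rest v → ℕ) : Set ((Node V → T) × (Node V → E)) :=
  {q | (∀ u : Rest v, label (Finset.univ.erase v) q.2 u.1 = ζ u) ∧
    ∀ u : Rest v, label ((layerNodes V (layer u.1)).erase v) q.1 u.1 = η u}

/-- The part of `restEvent ζ η` where node `v` has profile `h`. -/
def assignedEvent (ζ η : Rest v → ℕ) (h : ℕ) : Set ((Node V → T) × (Node V → E)) :=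
  {q | q ∈ restEvent ζ η ∧ label (Finset.univ.erase v) q.2 v = h}

theorem mem_restEvent_congr {q q' : (Node V → T) × (Node V → E)}
    (h₁ : ∀ u, u ≠ v → q.1 u = q'.1 u) (h₂ : ∀ u, u ≠ v → q.2 u = q'.2 u) :
    q ∈ restEvent ζ η ↔ q' ∈ restEvent ζ η := by
  have hne : ∀ (S : Finset (Node V)) (u : Rest v), ∀ a ∈ insert u.1 (S.erase v), a ≠ v := by
    intro S u a ha
    rcases Finset.mem_insert.1 ha with rfl | ha
    · exact u.2
    · exact Finset.ne_of_mem_erase ha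
  refine and_congr (forall_congr' fun u => ?_) (forall_congr' fun u => ?_)
  · rw [label_congr fun a ha b hb => by rw [h₂ a (hne _ u a ha), h₂ b (hne _ u b hb)]]
  · rw [label_congr fun a ha b hb => by rw [h₁ a (hne _ u a ha), h₁ b (hne _ u b hb)]]

theorem mem_assignedEvent_congr {h : ℕ} {t t' : Node V → T} {x : Node V → E}
    (ht : ∀ u, u ≠ v → t u = t' u) :
    (t, x) ∈ assignedEvent ζ η h ↔ (t', x) ∈ assignedEvent ζ η h :=
  and_congr (mem_restEvent_congr ht fun _ _ => rfl) Iff.rfl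

theorem update_mem_assignedEvent {h : ℕ} {t : Node V → T} {x : Node V → E} {u : Node V}
    (hu : u ≠ v) :
    (t, Function.update x v (x u)) ∈ assignedEvent ζ η h ↔
      (t, x) ∈ restEvent ζ η ∧ ζ ⟨u, hu⟩ = h := by
  have h1 : (t, Function.update x v (x u)) ∈ restEvent ζ η ↔ (t, x) ∈ restEvent ζ η :=
    mem_restEvent_congr (fun _ _ => rfl) fun a ha => Function.update_of_ne ha _ _
  have h2 : label (Finset.univ.erase v) (Function.update x v (x u)) v =
      label (Finset.univ.erase v) x u := by
    rw [label_congr_value (i' := u) (by rw [Function.update_self, Function.update_of_ne hu])]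
    refine label_congr fun a ha b hb => ?_
    have hne : ∀ a ∈ insert u (Finset.univ.erase v), a ≠ v := fun a ha => by
      rcases Finset.mem_insert.1 ha with rfl | ha
      · exact hu
      · exact Finset.ne_of_mem_erase ha
    rw [Function.update_of_ne (hne a ha), Function.update_of_ne (hne b hb)]
  change _ ∧ label (Finset.univ.erase v) (Function.update x v (x u)) v = h ↔ _
  rw [h1, h2]
  exact and_congr_right fun hr => by rw [hr.1 ⟨u, hu⟩]

theorem image_rest {α : Type*} [DecidableEq α] (x : Node V → α) :
    (Finset.univ.image fun u : Rest v => x u.1) = (Finset.univ.erase v).image x := by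
  ext y
  simp [Finset.mem_image]

theorem numClusters_eq {α : Type*} [DecidableEq α] {x : Node V → α}
    (hx : ∀ u : Rest v, label (Finset.univ.erase v) x u.1 = ζ u) :
    numClusters ζ = ((Finset.univ.erase v).image x).card ∧
      Finset.univ.image ζ = Finset.Icc 1 (numClusters ζ) := by
  have h1 : Finset.univ.image ζ = Finset.Icc 1 ((Finset.univ.erase v).image x).card := by
    rw [← image_label, ← image_rest]
    exact Finset.image_congr fun u _ => (hx u).symm
  have h2 : numClusters ζ = ((Finset.univ.erase v).image x).card := by
    rw [numClusters, h1, Nat.card_Icc, Nat.add_sub_cancel]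
  exact ⟨h2, by rw [h1, h2]⟩

theorem update_new_mem_assignedEvent {h : ℕ} {t : Node V → T} {x : Node V → E} {y : E}
    (hy : ∀ u, u ≠ v → x u ≠ y) :
    (t, Function.update x v y) ∈ assignedEvent ζ η h ↔
      (t, x) ∈ restEvent ζ η ∧ h = numClusters ζ + 1 := by
  classical
  have h1 : (t, Function.update x v y) ∈ restEvent ζ η ↔ (t, x) ∈ restEvent ζ η :=
    mem_restEvent_congr (fun _ _ => rfl) fun a ha => Function.update_of_ne ha _ _
  have h2 : label (Finset.univ.erase v) (Function.update x v y) v =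
      ((Finset.univ.erase v).image x).card + 1 := by
    rw [label_of_new fun k hk => ?_]
    · congr 2
      exact Finset.image_congr fun a ha => Function.update_of_ne (Finset.ne_of_mem_erase ha) _ _
    · rw [Function.update_self, Function.update_of_ne (Finset.ne_of_mem_erase hk)]
      exact hy k (Finset.ne_of_mem_erase hk)
  change _ ∧ label (Finset.univ.erase v) (Function.update x v y) v = h ↔ _
  rw [h1, h2]
  refine and_congr_right fun hr => ?_
  rw [(numClusters_eq hr.1).1]
  exact eq_comm

/-- With representatives taken outside `v`, no other node reads the root draw at `v`. This isolates
that draw for the root urn. -/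
theorem subgroupRep_ne {t : Node V → T} {u : Node V} (hu : u ≠ v) :
    subgroupRep (Finset.univ.erase v) t u ≠ v :=
  Finset.ne_of_mem_erase (rep_mem (Finset.mem_erase.2 ⟨hu, Finset.mem_univ u⟩))

theorem layer_subgroupRep (S : Finset (Node V)) (t : Node V → T) (u : Node V) :
    layer (subgroupRep S t u) = layer u :=
  (Prod.ext_iff.1 (apply_rep S (fun u => (layer u, t u)) u)).1

theorem apply_subgroupRep (S : Finset (Node V)) (t : Node V → T) (u : Node V) :
    t (subgroupRep S t u) = t u :=
  (Prod.ext_iff.1 (apply_rep S (fun u => (layer u, t u)) u)).2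

theorem erase_subsingleton (v : Node V) :
    ∀ a b, a ∉ Finset.univ.erase v → b ∉ Finset.univ.erase v → a = b := by
  intro a b ha hb
  simp only [Finset.mem_erase, Finset.mem_univ, and_true, not_not] at ha hb
  rw [ha, hb]

theorem subgroupRep_update {t : Node V → T} {y : T} {u : Node V} (hu : u ≠ v) :
    subgroupRep (Finset.univ.erase v) (Function.update t v y) u =
      subgroupRep (Finset.univ.erase v) t u :=
  rep_congr fun a ha => by
    rw [Function.update_of_ne hu, Function.update_of_ne (Finset.ne_of_mem_erase ha)]

/-- Copying the subgroup variable of `u` within the layer puts `v` in the subgroup of `u`, so `v`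
also takes its profile. -/
theorem joinProfiles_update_old {t : Node V → T} {x : Node V → E} {u : Node V} (hu : u ≠ v)
    (hl : layer u = layer v) :
    (joinProfiles (Finset.univ.erase v) (Function.update t v (t u), x)).2 =
      Function.update (joinProfiles (Finset.univ.erase v) (t, x)).2 v
        ((joinProfiles (Finset.univ.erase v) (t, x)).2 u) := by
  funext a
  by_cases ha : a = v
  · subst ha
    rw [Function.update_self]
    simp only [joinProfiles]
    rw [← subgroupRep_update (y := t u) hu]
    congr 1
    rw [subgroupRep_eq_iff (erase_subsingleton _)]
    exact ⟨hl.symm, by rw [Function.update_self, Function.update_of_ne hu]⟩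
  · rw [Function.update_of_ne ha]
    simp only [joinProfiles]
    rw [subgroupRep_update ha]

/-- Alone in its subgroup, `v` is its own representative and reads its own root draw. -/
theorem joinProfiles_update_new {t : Node V → T} {x : Node V → E} {y : T}
    (hy : ∀ u, t u ≠ y) :
    (joinProfiles (Finset.univ.erase v) (Function.update t v y, x)).2 =
      Function.update (joinProfiles (Finset.univ.erase v) (t, x)).2 v (x v) := by
  funext a
  by_cases ha : a = v
  · subst ha
    rw [Function.update_self]
    simp only [joinProfiles]
    congr 1
    refine rep_of_new fun b hb hK => hy b ?_
    have := (Prod.ext_iff.1 hK).2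
    simpa [Function.update_of_ne (Finset.ne_of_mem_erase hb)] using this
  · rw [Function.update_of_ne ha]
    simp only [joinProfiles]
    rw [subgroupRep_update ha]

theorem update_joinProfiles_update {t : Node V → T} {x : Node V → E} {y : E} :
    Function.update (joinProfiles (Finset.univ.erase v) (t, Function.update x v y)).2 v
        (Function.update x v y v) =
      Function.update (joinProfiles (Finset.univ.erase v) (t, x)).2 v y := by
  funext a
  by_cases ha : a = v
  · subst ha
    simp
  · rw [Function.update_of_ne ha, Function.update_of_ne ha]
    simp only [joinProfiles]
    rw [Function.update_of_ne (subgroupRep_ne ha)]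

/-- `ζ` is constant on the subgroups of `η`, and its labels are `1, …, H`. -/
structure IsCompatible (ζ η : Rest v → ℕ) : Prop where
  const : ∀ a b : Rest v, layer a.1 = layer b.1 → η a = η b → ζ a = ζ b
  image : Finset.univ.image ζ = Finset.Icc 1 (numClusters ζ)

theorem subgroup_eq_iff {t : Node V → T}
    (ht : ∀ u : Rest v, label ((layerNodes V (layer u.1)).erase v) t u.1 = η u)
    {a b : Rest v} (hab : layer a.1 = layer b.1) : t a.1 = t b.1 ↔ η a = η b := by
  rw [← ht a, ← ht b, hab]
  exact (label_eq_label_iff (Finset.mem_erase.2 ⟨b.2, mem_layerNodes.2 rfl⟩)).symm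

/-- Each subgroup has exactly one representative, and by compatibility the representative carries
the profile of the subgroup. Labels `η` restart in each layer, so the count is made layer by layer.
-/
theorem card_reps_with (hc : IsCompatible ζ η) {t : Node V → T}
    (ht : ∀ u : Rest v, label ((layerNodes V (layer u.1)).erase v) t u.1 = η u) (h : ℕ) :
    ((Finset.univ.image fun u : Rest v =>
      (⟨subgroupRep (Finset.univ.erase v) t u.1, subgroupRep_ne u.2⟩ : Rest v)).filter
        fun q => ζ q = h).card = subgroupsWith ζ η h := by
  set f : Rest v → Rest v := fun u =>
    ⟨subgroupRep (Finset.univ.erase v) t u.1, subgroupRep_ne u.2⟩ with hf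
  have hfl : ∀ u, layer (f u).1 = layer u.1 := fun u => layer_subgroupRep _ _ _
  have hfζ : ∀ u, ζ (f u) = ζ u := fun u =>
    hc.const _ _ (hfl u) ((subgroup_eq_iff ht (hfl u)).1 (apply_subgroupRep _ _ _))
  rw [Finset.card_eq_sum_card_fiberwise (f := fun q : Rest v => layer q.1) (t := Finset.univ)
    (by simp)]
  refine Finset.sum_congr rfl fun j _ => ?_
  have himg : (((Finset.univ.image f).filter fun q => ζ q = h).filter fun q => layer q.1 = j) =
      (Finset.univ.filter fun u : Rest v => layer u.1 = j ∧ ζ u = h).image f := by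
    ext q
    simp only [Finset.mem_filter, Finset.mem_image, Finset.mem_univ, true_and]
    constructor
    · rintro ⟨⟨⟨u, rfl⟩, hζ⟩, hl⟩
      exact ⟨u, ⟨by rw [← hfl, hl], by rw [← hfζ, hζ]⟩, rfl⟩
    · rintro ⟨u, ⟨hl, hζ⟩, rfl⟩
      exact ⟨⟨⟨u, rfl⟩, by rw [hfζ, hζ]⟩, by rw [hfl, hl]⟩
  rw [himg, subgroupCount]
  refine card_image_eq_of_ker fun a ha b hb => ?_
  have hab : layer a.1 = layer b.1 := by
    rw [(Finset.mem_filter.1 ha).2.1, (Finset.mem_filter.1 hb).2.1]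
  rw [hf, Subtype.mk.injEq, subgroupRep_eq_iff (erase_subsingleton v), ← subgroup_eq_iff ht hab]
  exact and_iff_right hab

theorem card_reps (hc : IsCompatible ζ η) {t : Node V → T}
    (ht : ∀ u : Rest v, label ((layerNodes V (layer u.1)).erase v) t u.1 = η u) :
    (Finset.univ.image fun u : Rest v =>
      (⟨subgroupRep (Finset.univ.erase v) t u.1, subgroupRep_ne u.2⟩ : Rest v)).card =
      subgroupsTotal ζ η := by
  rw [Finset.card_eq_sum_card_fiberwise (f := ζ) (t := Finset.Icc 1 (numClusters ζ))
    (fun q _ => by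
      rw [← hc.image]
      exact Finset.mem_coe.2 (Finset.mem_image_of_mem ζ (Finset.mem_univ q))),
    subgroupsTotal, Finset.sum_comm]
  exact Finset.sum_congr rfl fun h _ => card_reps_with hc ht h

/-- The labels of `ζ` fill `1, …, H`, so within the admissible range only `H + 1` is unused. -/
theorem subgroupsWith_eq_zero_iff (hc : IsCompatible ζ η) {h : ℕ}
    (hh : h ∈ Finset.Icc 1 (numClusters ζ + 1)) :
    subgroupsWith ζ η h = 0 ↔ h = numClusters ζ + 1 := by
  have hmem : h ∈ Finset.univ.image ζ ↔ h ≠ numClusters ζ + 1 := by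
    rw [hc.image]
    simp only [Finset.mem_Icc] at hh ⊢
    omega
  constructor
  · intro h0
    by_contra hne
    obtain ⟨u, -, hu⟩ := Finset.mem_image.1 (hmem.2 hne)
    have := (Finset.sum_eq_zero_iff.1 h0) (layer u.1) (Finset.mem_univ _)
    rw [subgroupCount, Finset.card_eq_zero, Finset.image_eq_empty] at this
    exact absurd this (Finset.Nonempty.ne_empty ⟨u, by simp [hu]⟩)
  · intro heq
    refine Finset.sum_eq_zero fun j _ => ?_
    rw [subgroupCount, Finset.card_eq_zero, Finset.image_eq_empty, Finset.filter_eq_empty_iff]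
    rintro u - ⟨-, hu⟩
    exact hmem.1 (Finset.mem_image.2 ⟨u, Finset.mem_univ _, hu⟩) heq

theorem nodeCount_eq_zero (hc : IsCompatible ζ η) (j : Fin d) :
    nodeCount ζ j (numClusters ζ + 1) = 0 := by
  rw [nodeCount, Finset.card_eq_zero, Finset.filter_eq_empty_iff]
  rintro u - ⟨-, hu⟩
  have : ζ u ∈ Finset.univ.image ζ := Finset.mem_image_of_mem ζ (Finset.mem_univ u)
  rw [hc.image, Finset.mem_Icc, hu] at this
  omega

theorem card_layer_rest (v : Node V) :
    ((Finset.univ.erase v).filter fun u => layer u = layer v).card + 1 = V (layer v) := by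
  have h1 : ((Finset.univ.erase v).filter fun u => layer u = layer v) =
      (layerNodes V (layer v)).erase v := by
    ext u
    simp [layerNodes]
  rw [h1, Finset.card_erase_add_one (mem_layerNodes.2 rfl)]
  have h2 : layerNodes V (layer v) =
      Finset.univ.image fun i : Fin (V (layer v)) => (toLex ⟨layer v, i⟩ : Node V) := by
    ext u
    simp only [mem_layerNodes, Finset.mem_image, Finset.mem_univ, true_and]
    constructor
    · intro hu
      obtain ⟨⟨j, i⟩, rfl⟩ := toLex.surjective u
      have hj : j = layer v := hu
      subst hj
      exact ⟨i, rfl⟩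
    · rintro ⟨i, rfl⟩
      rfl
  rw [h2, Finset.card_image_of_injective, Finset.card_univ, Fintype.card_fin]
  intro a b hab
  have := toLex.injective hab
  simpa using this

end RemoveNode

/-! ### The two urn steps at the removed node -/

section RemoveNodeLaw

variable {d : ℕ} {V : Fin d → ℕ} {E T : Type*} {v : Node V} {ζ η : Rest v → ℕ} {h : ℕ}
  [MeasurableSpace E] [StandardBorelSpace E] [MeasurableSpace T] [StandardBorelSpace T]

theorem measurable_label (S : Finset (Node V)) (u : Node V) :
    Measurable fun x : Node V → E => label S x u :=
  measurable_of_ker fun _ _ hxy => label_congr fun a _ b _ => hxy a b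

theorem measurableSet_restEvent :
    MeasurableSet (restEvent ζ η : Set ((Node V → T) × (Node V → E))) := by
  have h1 : MeasurableSet (⋂ u : Rest v, {q : (Node V → T) × (Node V → E) |
      label (Finset.univ.erase v) q.2 u.1 = ζ u}) := MeasurableSet.iInter fun u =>
    ((measurable_label _ _).comp measurable_snd) (measurableSet_singleton (ζ u))
  have h2 : MeasurableSet (⋂ u : Rest v, {q : (Node V → T) × (Node V → E) |
      label ((layerNodes V (layer u.1)).erase v) q.1 u.1 = η u}) := MeasurableSet.iInter fun u =>
    ((measurable_label _ _).comp measurable_fst) (measurableSet_singleton (η u))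
  convert h1.inter h2
  ext q
  simp [restEvent]

theorem measurableSet_assignedEvent :
    MeasurableSet (assignedEvent ζ η h : Set ((Node V → T) × (Node V → E))) :=
  measurableSet_restEvent.inter
    (((measurable_label _ _).comp measurable_snd) (measurableSet_singleton h))

omit [MeasurableSpace E] [StandardBorelSpace E] [MeasurableSpace T] [StandardBorelSpace T] in
theorem joinProfiles_subgroupRep (t : Node V → T) (x : Node V → E) (u : Node V) :
    (joinProfiles (Finset.univ.erase v) (t, x)).2 (subgroupRep (Finset.univ.erase v) t u) =
      x (subgroupRep (Finset.univ.erase v) t u) := by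
  simp only [joinProfiles]
  congr 1
  rw [subgroupRep_eq_iff (erase_subsingleton v)]
  exact ⟨layer_subgroupRep _ _ _, apply_subgroupRep _ _ _⟩

/-- The law of the profile of node `v`, given that it forms a subgroup of its own. -/
theorem IsUrn.measure_new_subgroup {θ₀ : ℝ} {P₀ : Measure E} [IsProbabilityMeasure P₀]
    [NullSingletonClass P₀] {ν : Measure (Node V → E)} (hν : IsUrn θ₀ (fun _ => ()) (fun _ => P₀) ν)
    (hc : IsCompatible ζ η) (t : Node V → T) :
    (ENNReal.ofReal θ₀ + subgroupsTotal ζ η) *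
      ν {y | (t, Function.update (joinProfiles (Finset.univ.erase v) (t, y)).2 v (y v)) ∈
        assignedEvent ζ η h} =
      ((if h = numClusters ζ + 1 then ENNReal.ofReal θ₀ else 0) + subgroupsWith ζ η h) *
        ν {y | joinProfiles (Finset.univ.erase v) (t, y) ∈ restEvent ζ η} := by
  classical
  set A := {y : Node V → E |
    (t, Function.update (joinProfiles (Finset.univ.erase v) (t, y)).2 v (y v)) ∈
      assignedEvent ζ η h} with hA
  set B := {y : Node V → E | joinProfiles (Finset.univ.erase v) (t, y) ∈ restEvent ζ η} with hB
  by_cases ht : ∀ u : Rest v, label ((layerNodes V (layer u.1)).erase v) t u.1 = η u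
  swap
  · have hA0 : A = ∅ := Set.eq_empty_of_forall_notMem fun y hy => ht hy.1.2
    have hB0 : B = ∅ := Set.eq_empty_of_forall_notMem fun y hy => ht hy.2
    rw [hA0, hB0, measure_empty, mul_zero, mul_zero]
  set f : Rest v → Rest v := fun u =>
    ⟨subgroupRep (Finset.univ.erase v) t u.1, subgroupRep_ne u.2⟩ with hf
  set I : Finset (Rest v) := Finset.univ.image f with hI
  -- The event depends on the root draws at `v` and at the representatives only, so the root urn is
  -- run over these: one earlier draw for each subgroup.
  set S : Finset (Node V) := I.map (Function.Embedding.subtype _) with hS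
  have hj : Measurable fun y : Node V → E => (joinProfiles (Finset.univ.erase v) (t, y)).2 :=
    (measurable_snd.comp (measurable_joinProfiles _)).comp measurable_prodMk_left
  have hAm : MeasurableSet A :=
    (measurable_const.prodMk
      (measurable_update'.comp (hj.prodMk (measurable_pi_apply v)))) measurableSet_assignedEvent
  have hBm : MeasurableSet B := (measurable_const.prodMk hj) measurableSet_restEvent
  have hvS : v ∉ S := by
    simp [hS]
  have hdep : ∀ x y : Node V → E, (∀ u ∈ insert v S, x u = y u) →
      A.indicator (1 : (Node V → E) → ℝ≥0∞) x = A.indicator 1 y := by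
    intro x y hxy
    have : Function.update (joinProfiles (Finset.univ.erase v) (t, x)).2 v (x v) =
        Function.update (joinProfiles (Finset.univ.erase v) (t, y)).2 v (y v) := by
      funext a
      by_cases ha : a = v
      · subst ha
        rw [Function.update_self, Function.update_self]
        exact hxy a (Finset.mem_insert_self _ _)
      · rw [Function.update_of_ne ha, Function.update_of_ne ha]
        refine hxy _ (Finset.mem_insert_of_mem ?_)
        exact Finset.mem_map.2 ⟨f ⟨a, ha⟩, Finset.mem_image_of_mem f (Finset.mem_univ _), rfl⟩
    have hiff : x ∈ A ↔ y ∈ A := by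
      rw [hA, Set.mem_ofPred_eq, Set.mem_ofPred_eq, this]
    by_cases hx : x ∈ A
    · rw [Set.indicator_of_mem hx, Set.indicator_of_mem (hiff.1 hx)]
      rfl
    · rw [Set.indicator_of_notMem hx, Set.indicator_of_notMem fun hy => hx (hiff.2 hy)]
  have hmem : ∀ x y, Function.update x v y ∈ A ↔
      (t, Function.update (joinProfiles (Finset.univ.erase v) (t, x)).2 v y) ∈
        assignedEvent ζ η h := by
    intro x y
    rw [hA, Set.mem_ofPred_eq, update_joinProfiles_update]
  have hnew : ∀ (x : Node V → E) (y : E), (∀ u, x u ≠ y) →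
      A.indicator (1 : (Node V → E) → ℝ≥0∞) (Function.update x v y) =
        (if h = numClusters ζ + 1 then 1 else 0) * B.indicator 1 x := by
    intro x y hy
    have hiff := (hmem x y).trans (update_new_mem_assignedEvent fun u _ => hy _)
    change _ ↔ x ∈ B ∧ _ at hiff
    simp only [Set.indicator_apply, Pi.one_apply, hiff]
    by_cases hx : x ∈ B <;> by_cases hh : h = numClusters ζ + 1 <;> simp [hx, hh]
  have hold : ∀ q ∈ I, ∀ x : Node V → E,
      A.indicator (1 : (Node V → E) → ℝ≥0∞) (Function.update x v (x q.1)) =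
        (if ζ q = h then 1 else 0) * B.indicator 1 x := by
    intro q hq x
    obtain ⟨u, -, rfl⟩ := Finset.mem_image.1 hq
    have hxq : x (f u).1 = (joinProfiles (Finset.univ.erase v) (t, x)).2 (f u).1 :=
      (joinProfiles_subgroupRep t x u.1).symm
    have hiff := hmem x (x (f u).1)
    rw [hxq, update_mem_assignedEvent (f u).2, ← hxq] at hiff
    change _ ↔ x ∈ B ∧ _ at hiff
    simp only [Set.indicator_apply, Pi.one_apply, hiff]
    by_cases hx : x ∈ B <;> by_cases hh : ζ (f u) = h <;> simp [hx, hh]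
  have key := hν.lintegral_eq hvS (measurable_one.indicator hAm) hdep hnew
  have hcard : (S.filter fun _ => () = ()).card = subgroupsTotal ζ η := by
    rw [Finset.filter_true_of_mem fun _ _ => rfl, hS, Finset.card_map, hI, card_reps hc ht]
  rw [lintegral_indicator_one hAm, hcard, lintegral_const_mul _ (measurable_one.indicator hBm),
    lintegral_indicator_one hBm, Finset.filter_true_of_mem fun _ _ => rfl, hS,
    Finset.sum_map] at key
  rw [key, add_mul]
  congr 1
  · split_ifs <;> simp
  · have : ∀ q ∈ I, ∫⁻ x, A.indicator (1 : (Node V → E) → ℝ≥0∞)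
        (Function.update x v (x (Function.Embedding.subtype _ q))) ∂ν =
          if ζ q = h then ν B else 0 := by
      intro q hq
      refine (lintegral_congr (hold q hq)).trans ?_
      rw [lintegral_const_mul _ (measurable_one.indicator hBm),
        lintegral_indicator_one hBm]
      split_ifs <;> simp
    rw [Finset.sum_congr rfl this, ← Finset.sum_filter, Finset.sum_const, nsmul_eq_mul,
      card_reps_with hc ht]

/-- The layer urn at `v` splits the event: copying a node `u` of the layer assigns `ζ u`, and these
terms add up to `nodeCount`; a fresh value leaves `v` alone and is handled by
`measure_new_subgroup`. Denominators are multiplied out to stay in `ℝ≥0∞`. -/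
theorem IsUrn.measure_assignedEvent {θ θ₀ : ℝ} {P₀ : Measure E}
    [IsProbabilityMeasure P₀] [NullSingletonClass P₀] {G : Fin d → Measure T}
    [∀ j, IsProbabilityMeasure (G j)] [∀ j, NullSingletonClass (G j)]
    {νt : Measure (Node V → T)} {ν : Measure (Node V → E)} [IsFiniteMeasure ν]
    (hνt : IsUrn θ layer G νt) (hν : IsUrn θ₀ (fun _ => ()) (fun _ => P₀) ν)
    (hc : IsCompatible ζ η) :
    (ENNReal.ofReal θ₀ + subgroupsTotal ζ η) *
      ((ENNReal.ofReal θ +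
        ((Finset.univ.erase v).filter fun u => layer u = layer v).card) *
      (νt.prod ν).map (joinProfiles (Finset.univ.erase v)) (assignedEvent ζ η h)) =
      (ENNReal.ofReal θ *
        ((if h = numClusters ζ + 1 then ENNReal.ofReal θ₀ else 0) + subgroupsWith ζ η h) +
      (ENNReal.ofReal θ₀ + subgroupsTotal ζ η) * nodeCount ζ (layer v) h) *
      (νt.prod ν).map (joinProfiles (Finset.univ.erase v)) (restEvent ζ η) := by
  classical
  have hjm := measurable_joinProfiles (T := T) (E := E) (Finset.univ.erase v)
  have hWm : MeasurableSet (joinProfiles (Finset.univ.erase v) ⁻¹'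
      (assignedEvent ζ η h : Set ((Node V → T) × (Node V → E)))) :=
    hjm measurableSet_assignedEvent
  have hBm : MeasurableSet (joinProfiles (Finset.univ.erase v) ⁻¹'
      (restEvent ζ η : Set ((Node V → T) × (Node V → E)))) := hjm measurableSet_restEvent
  rw [Measure.map_apply hjm measurableSet_assignedEvent,
    Measure.map_apply hjm measurableSet_restEvent, Measure.prod_apply hWm, Measure.prod_apply hBm]
  set F : (Node V → T) → ℝ≥0∞ := fun t => ν (Prod.mk t ⁻¹'
    (joinProfiles (Finset.univ.erase v) ⁻¹' assignedEvent ζ η h)) with hF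
  set FB : (Node V → T) → ℝ≥0∞ := fun t => ν (Prod.mk t ⁻¹'
    (joinProfiles (Finset.univ.erase v) ⁻¹' restEvent ζ η)) with hFB
  set F₀ : (Node V → T) → ℝ≥0∞ := fun t => ν {y |
    (t, Function.update (joinProfiles (Finset.univ.erase v) (t, y)).2 v (y v)) ∈
        assignedEvent ζ η h} with hF₀
  have hFm : Measurable F := measurable_measure_prodMk_left hWm
  have hFBm : Measurable FB := measurable_measure_prodMk_left hBm
  -- The event ignores the subgroup variable of `v`, which acts only through the profile that it
  -- selects.
  have hset : ∀ t y, Prod.mk (Function.update t v y) ⁻¹'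
      (joinProfiles (Finset.univ.erase v) ⁻¹' (assignedEvent ζ η h :
        Set ((Node V → T) × (Node V → E)))) = {x |
      (t, (joinProfiles (Finset.univ.erase v) (Function.update t v y, x)).2) ∈
        assignedEvent ζ η h} := by
    intro t y
    ext x
    exact mem_assignedEvent_congr fun u hu => Function.update_of_ne hu _ _
  have hnew : ∀ t y, (∀ u, t u ≠ y) → F (Function.update t v y) = F₀ t := by
    intro t y hy
    simp only [hF, hF₀, hset, joinProfiles_update_new hy]
  have hold : ∀ u : Rest v, layer u.1 = layer v → ∀ t,
      F (Function.update t v (t u.1)) = (if ζ u = h then 1 else 0) * FB t := by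
    intro u hu t
    simp only [hF, hset, joinProfiles_update_old u.2 hu, update_mem_assignedEvent u.2]
    split_ifs with hh
    · simp only [hh, and_true, one_mul]
      rfl
    · simp [hh]
  have key := hνt.lintegral_eq (Finset.notMem_erase v Finset.univ) hFm
    (fun x y hxy => by
      rw [show x = y from funext fun u => hxy u (by simp)]) hnew
  have hfilter : ((Finset.univ.erase v).filter fun u => layer u = layer v) =
      (Finset.univ.filter fun u : Rest v => layer u.1 = layer v).map
        (Function.Embedding.subtype _) := by
    ext u
    simp only [Finset.mem_filter, Finset.mem_erase, Finset.mem_univ, and_true, true_and,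
      Finset.mem_map, Function.Embedding.subtype_apply]
    exact ⟨fun hu => ⟨⟨u, hu.1⟩, hu.2, rfl⟩, by rintro ⟨a, ha, rfl⟩; exact ⟨a.2, ha⟩⟩
  have hroot : (ENNReal.ofReal θ₀ + subgroupsTotal ζ η) * ∫⁻ t, F₀ t ∂νt =
      ((if h = numClusters ζ + 1 then ENNReal.ofReal θ₀ else 0) + subgroupsWith ζ η h) *
        ∫⁻ t, FB t ∂νt := by
    rw [← lintegral_const_mul' _ _ (by finiteness), ← lintegral_const_mul' _ _ (by
      split_ifs <;> finiteness)]
    exact lintegral_congr fun t => hν.measure_new_subgroup hc t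
  have hsum : ∑ u' ∈ (Finset.univ.erase v).filter (fun u => layer u = layer v),
      ∫⁻ t, F (Function.update t v (t u')) ∂νt = nodeCount ζ (layer v) h * ∫⁻ t, FB t ∂νt := by
    rw [hfilter, Finset.sum_map]
    have : ∀ u ∈ Finset.univ.filter (fun u : Rest v => layer u.1 = layer v),
        ∫⁻ t, F (Function.update t v (t (Function.Embedding.subtype _ u))) ∂νt =
          if ζ u = h then ∫⁻ t, FB t ∂νt else 0 := by
      intro u hu
      refine (lintegral_congr (hold u (Finset.mem_filter.1 hu).2)).trans ?_
      rw [lintegral_const_mul _ hFBm]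
      split_ifs <;> simp
    rw [Finset.sum_congr rfl this, ← Finset.sum_filter, Finset.filter_filter, Finset.sum_const,
      nsmul_eq_mul, nodeCount]
  rw [key, hsum, mul_add, mul_left_comm, hroot]
  ring

-- A realization cannot give one subgroup two profiles, so compatibility comes for free from any
-- outcome in the event.
omit [MeasurableSpace E] [StandardBorelSpace E] [MeasurableSpace T] [StandardBorelSpace T] in
theorem isCompatible_of_mem {t : Node V → T} {s : Fin d × ℕ → E}
    (hr : (t, profiles t s) ∈ restEvent ζ η) : IsCompatible ζ η := by
  classical
  refine ⟨fun a b hab hη => ?_, (numClusters_eq hr.1).2⟩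
  have htab := (subgroup_eq_iff hr.2 hab).2 hη
  rw [← hr.1 a, ← hr.1 b]
  refine label_congr_value ?_
  simp only [profiles, hab, (subgroups_eq_iff hab).2 htab]

end RemoveNodeLaw

/-! ### Passage to real conditional probabilities -/

section Franchise

variable {Ω E T : Type*} [MeasurableSpace Ω]
  [MeasurableSpace E] [StandardBorelSpace E] [MeasurableSpace T] [StandardBorelSpace T]
  {μ : Measure Ω} [IsProbabilityMeasure μ]
  {d : ℕ} {V : Fin d → ℕ} {θ θ₀ : ℝ}
  {P₀ : Measure E} [IsProbabilityMeasure P₀] [NullSingletonClass P₀]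
  {G : Fin d → Measure T} [∀ j, IsProbabilityMeasure (G j)] [∀ j, NullSingletonClass (G j)]
  {R : Ω → Measure E} {Q : Fin d → Ω → Measure T}
  {t : Node V → Ω → T} {s : Fin d × ℕ → Ω → E}

theorem IsFranchise.toReal_measure_assigned (hM : IsFranchise V θ θ₀ P₀ G μ R Q t s) (hθ : 0 < θ)
    (hθ₀ : 0 < θ₀) {v : Node V} {ζ η : Rest v → ℕ}
    (hpos : μ ((fun ω => ((fun u => t u ω), profiles (fun u => t u ω) fun p => s p ω)) ⁻¹'
      restEvent ζ η) ≠ 0)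
    {h : ℕ} (hh : h ∈ Finset.Icc 1 (numClusters ζ + 1)) :
    (μ ((fun ω => ((fun u => t u ω), profiles (fun u => t u ω) fun p => s p ω)) ⁻¹'
      assignedEvent ζ η h)).toReal =
      (μ ((fun ω => ((fun u => t u ω), profiles (fun u => t u ω) fun p => s p ω)) ⁻¹'
        restEvent ζ η)).toReal *
      if subgroupsWith ζ η h = 0 then
        θ₀ / (θ₀ + subgroupsTotal ζ η) * (θ / (θ + V (layer v) - 1))
      else
        subgroupsWith ζ η h / (θ₀ + subgroupsTotal ζ η) * (θ / (θ + V (layer v) - 1))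
          + nodeCount ζ (layer v) h / (θ + V (layer v) - 1) := by
  -- Positive probability supplies an outcome, and with it the compatibility of `ζ` and `η`.
  obtain ⟨ω₀, hω₀⟩ := nonempty_of_measure_ne_zero hpos
  have hc : IsCompatible ζ η := isCompatible_of_mem hω₀
  obtain ⟨ν, hν⟩ := exists_isSampleLaw (ι := Node V) (μ := μ) hM.root.toIsRandomProbability
  have := hν.isProbabilityMeasure fun _ => hM.root.isProbabilityMeasure
  have htx := hM.measurable_subgroups.prodMk hM.measurable_profiles
  have key := (hM.isUrn_subgroups hθ).measure_assignedEvent (h := h) (hM.root.isUrn hθ₀ hν) hc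
  rw [← hM.map_eq (erase_subsingleton v) hν, Measure.map_apply htx measurableSet_assignedEvent,
    Measure.map_apply htx measurableSet_restEvent] at key
  have hN : (V (layer v) : ℝ) =
      ((Finset.univ.erase v).filter fun u => layer u = layer v).card + 1 := by
    exact_mod_cast (card_layer_rest v).symm
  have keyR := congrArg ENNReal.toReal key
  have hif : (if h = numClusters ζ + 1 then ENNReal.ofReal θ₀ else 0) ≠ ∞ := by
    split_ifs <;> finiteness
  simp only [ENNReal.toReal_mul] at keyR
  rw [ENNReal.toReal_add (by finiteness) (by finiteness),
    ENNReal.toReal_add (by finiteness) (by finiteness),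
    ENNReal.toReal_add (by finiteness) (by finiteness), ENNReal.toReal_mul, ENNReal.toReal_mul,
    ENNReal.toReal_add hif (by finiteness),
    ENNReal.toReal_add (by finiteness) (by finiteness), ENNReal.toReal_ofReal hθ.le,
    ENNReal.toReal_ofReal hθ₀.le] at keyR
  simp only [ENNReal.toReal_natCast] at keyR
  rw [hN]
  set N : ℝ := (((Finset.univ.erase v).filter fun u => layer u = layer v).card : ℝ)
  have hNpos : (0 : ℝ) ≤ N := Nat.cast_nonneg _
  have hL : (0 : ℝ) ≤ subgroupsTotal ζ η := Nat.cast_nonneg _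
  have h1 : θ + (N + 1) - 1 = θ + N := by ring
  rw [h1]
  have h2 : θ + N ≠ 0 := by positivity
  have h3 : θ₀ + (subgroupsTotal ζ η : ℝ) ≠ 0 := by positivity
  by_cases h0 : subgroupsWith ζ η h = 0
  -- At `h = H + 1` both counts vanish and only the product of the two fresh-draw weights remains.
  · have hn := (subgroupsWith_eq_zero_iff hc hh).1 h0
    rw [if_pos hn, ENNReal.toReal_ofReal hθ₀.le, h0, hn, nodeCount_eq_zero hc, ← hn] at keyR
    rw [if_pos h0]
    field_simp
    push_cast at keyR
    linear_combination keyR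
  · rw [if_neg fun hn => h0 ((subgroupsWith_eq_zero_iff hc hh).2 hn), ENNReal.toReal_zero] at keyR
    rw [if_neg h0]
    field_simp
    linear_combination keyR

end Franchise

end PExP

theorem corollary1
    {Ω E T : Type*} [MeasurableSpace Ω]
    [MeasurableSpace E] [StandardBorelSpace E] [MeasurableSpace T] [StandardBorelSpace T]
    (μ : Measure Ω) [IsProbabilityMeasure μ]
    {d : ℕ} (V : Fin d → ℕ) (θ θ₀ : ℝ) (hθ : 0 < θ) (hθ₀ : 0 < θ₀)
    (P₀ : Measure E) [IsProbabilityMeasure P₀] [NullSingletonClass P₀]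
    (G : Fin d → Measure T) [∀ j, IsProbabilityMeasure (G j)] [∀ j, NullSingletonClass (G j)]
    (R : Ω → Measure E) (Q : Fin d → Ω → Measure T)
    (t : Node V → Ω → T) (s : Fin d × ℕ → Ω → E)
    (hM : IsFranchise V θ θ₀ P₀ G μ R Q t s)
    (w z : Ω → Node V → ℕ)
    (hw : ∀ ω, w ω = subgroups fun u => t u ω)
    (hz : ∀ ω, z ω = allocation (profiles (fun u => t u ω) fun p => s p ω)) :
    -- `z ∼ pExP(V; θ, θ₀)`: `z` has the law of the partition induced by the H-DP
    (∀ (Ω' : Type*) [MeasurableSpace Ω'] (μ' : Measure Ω') [IsProbabilityMeasure μ']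
      (P₀' : Measure E) [IsProbabilityMeasure P₀'] [NullSingletonClass P₀']
      (R' : Ω' → Measure E) (P' : Fin d → Ω' → Measure E) (x' : Node V → Ω' → E),
      IsHDP θ θ₀ P₀' μ' R' P' →
      IsConditionalSample (MeasurableSpace.comap (fun ω j => P' j ω) inferInstance) μ'
        (fun u => P' (layer u)) x' →
      ∀ ζ : Node V → ℕ, μ {ω | z ω = ζ} = μ' {ω | allocation (fun u => x' u ω) = ζ}) ∧
    -- the urn scheme
    ∀ (v : Node V) (ζ η : Rest v → ℕ),
      μ {ω | removeAllocation v (z ω) = ζ ∧ removeSubgroups v (w ω) = η} ≠ 0 →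
      ∀ h ∈ Finset.Icc 1 (numClusters ζ + 1),
        (μ[{ω | assigned v (z ω) = h} |
            {ω | removeAllocation v (z ω) = ζ ∧ removeSubgroups v (w ω) = η}]).toReal =
          if subgroupsWith ζ η h = 0 then
            θ₀ / (θ₀ + subgroupsTotal ζ η) * (θ / (θ + V (layer v) - 1))
          else
            subgroupsWith ζ η h / (θ₀ + subgroupsTotal ζ η) * (θ / (θ + V (layer v) - 1))
              + nodeCount ζ (layer v) h / (θ + V (layer v) - 1) := by
  -- Since relabelled labels are labels of the original arrays, the conditioning event is a preimage
  -- under the pair of subgroup variables and profiles.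
  have hpre : ∀ (v : Node V) (ζ η : Rest v → ℕ),
      {ω | removeAllocation v (z ω) = ζ ∧ removeSubgroups v (w ω) = η} =
        (fun ω => ((fun u => t u ω), profiles (fun u => t u ω) fun p => s p ω)) ⁻¹'
          restEvent ζ η := by
    intro v ζ η
    ext ω
    simp only [Set.mem_ofPred_eq, hz, hw, removeAllocation_allocation, removeSubgroups_subgroups,
      funext_iff]
    rfl
  refine ⟨fun Ω' _ μ' _ P₀' _ _ R' P' x' h hx ζ => ?_, fun v ζ η hpos h hh => ?_⟩
  · simp only [hz]
    exact hM.allocation_law hθ hθ₀ h hx ζ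
  · rw [hpre] at hpos ⊢
    have hm := hM.measurable_subgroups.prodMk hM.measurable_profiles
      (measurableSet_restEvent (ζ := ζ) (η := η))
    have hinter : (fun ω => ((fun u => t u ω), profiles (fun u => t u ω) fun p => s p ω)) ⁻¹'
        restEvent ζ η ∩ {ω | assigned v (z ω) = h} =
        (fun ω => ((fun u => t u ω), profiles (fun u => t u ω) fun p => s p ω)) ⁻¹'
          assignedEvent ζ η h := by
      ext ω
      simp only [Set.mem_inter_iff, Set.mem_ofPred_eq, hz, assigned_allocation]
      rfl
    rw [cond_apply hm, hinter, ENNReal.toReal_mul, ENNReal.toReal_inv,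
      hM.toReal_measure_assigned hθ hθ₀ hpos hh, inv_mul_cancel_left₀]
    exact ENNReal.toReal_ne_zero.2 ⟨hpos, measure_ne_top _ _⟩
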